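/- Let $n,k,l\ge 1$ be integers and let $A_{k,l}=(-\Delta)^l+|x|^{2k}+1$ be the anharmonic oscillator on $\mathbb{R}^n$. Let $(u_j)_{j\in\mathbb{N}}$ be any orthonormal basis of the complex Hilbert space $L^2(\mathbb{R}^n)$ consisting of eigenfunctions of $A_{k,l}$, i.e. $0\ne u_j\in L^2(\mathbb{R}^n)$ and $A_{k,l}u_j=\lambda_j u_j$ in the sense of tempered distributions, for some numbers $\lambda_j$. For a function $f$ put $$\mathcal{F}_{A_{k,l}}f(j)=\int_{\mathbb{R}^n}f(x)\,\overline{u_j(x)}\,dx,\qquad j\in\mathbb{N}.$$ Let $1\le p\le 2$, $\frac1p+\frac1{p'}=1$, and let $f\in L^p(\mathbb{R}^n)$. Then $\|u_j\|_{L^\infty(\mathbb{R}^n)}<\infty$ and $f\,\overline{u_j}$ is integrable for every $j$ (so that all the quantities below are well defined), and $$\Big(\sum_{j\in\mathbb{N}}|\mathcal{F}_{A_{k,l}}f(j)|^{p'}\,\|u_j\|_{L^\infty(\mathbb{R}^n)}^{2-p'}\Big)^{1/p'}\le\|f\|_{L^p(\mathbb{R}^n)},$$ where for $p=1$, $p'=\infty$,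 the left-hand side is understood as $\sup_{j\in\mathbb{N}}|\mathcal{F}_{A_{k,l}}f(j)|\,\|u_j\|_{L^\infty(\mathbb{R}^n)}^{-1}$. -/

import Mathlib

open MeasureTheory
open scoped ENNReal SchwartzMap Laplacian ComplexConjugate

namespace Anharmonic

/-- The space `ℝⁿ` with its Euclidean norm. -/
abbrev Space (n : ℕ) : Type := EuclideanSpace ℝ (Fin n)

/-- The complex Hilbert space `L²(ℝⁿ)`. -/
abbrev L2 (n : ℕ) : Type := Lp ℂ 2 (volume : Measure (Space n))

/-- The potential `x ↦ |x|^{2k}` on `ℝⁿ`. -/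
noncomputable def potential (n k : ℕ) : Space n → ℂ := fun x ↦ ((‖x‖ ^ (2 * k) : ℝ) : ℂ)

/-- The potential has temperate growth, so `TemperedDistribution.smulLeftCLM` really is the
multiplication by it. -/
theorem potential_hasTemperateGrowth (n k : ℕ) :
    Function.HasTemperateGrowth (potential n k) := by
  have h : Function.HasTemperateGrowth (fun x : Space n ↦ (‖x‖ ^ 2) ^ k) := by
    fun_prop
  have h' : Function.HasTemperateGrowth (fun x : Space n ↦ (((‖x‖ ^ 2) ^ k : ℝ) : ℂ)) := by
    fun_prop
  have e : potential n k = fun x : Space n ↦ (((‖x‖ ^ 2) ^ k : ℝ) : ℂ) := by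
    funext x
    simp only [potential, pow_mul]
  rw [e]
  exact h'

/-- The anharmonic oscillator `A_{k,l} = (-Δ)^l + |x|^{2k} + 1`, acting on tempered
distributions on `ℝⁿ`. -/
noncomputable def oscillator (n k l : ℕ) (v : 𝓢'(Space n, ℂ)) : 𝓢'(Space n, ℂ) :=
  (fun w : 𝓢'(Space n, ℂ) ↦ -Δ w)^[l] v
    + TemperedDistribution.smulLeftCLM ℂ (potential n k) v + v

/-- `v` is an eigenfunction in `L²(ℝⁿ)` of the anharmonic oscillator `A_{k,l}` for the
eigenvalue `μ`: it is non-zero and `A_{k,l} v = μ v`, where the operator acts in the sense of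
distributions (its domain in `L²` consists of the `v` for which `A_{k,l} v` is again in `L²`). -/
def IsEigenfunction {n : ℕ} (k l : ℕ) (v : L2 n) (μ : ℂ) : Prop :=
  v ≠ 0 ∧ oscillator n k l (v : 𝓢'(Space n, ℂ)) = μ • (v : 𝓢'(Space n, ℂ))

/-- The Fourier transform `f ↦ (j ↦ ∫ f(x) conj(u_j(x)) dx)` associated with a sequence `u`. -/
noncomputable def fourierCoeff {n : ℕ} (u : ℕ → L2 n) (f : Space n → ℂ) (j : ℕ) : ℂ :=
  ∫ x, f x * conj (u j x)

/-- The norm `‖u_j‖_{L^∞}`, with values in `[0, ∞]`. -/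
noncomputable def supNorm {n : ℕ} (v : L2 n) : ℝ≥0∞ := eLpNorm v ∞ volume

/-- The norm of the weighted sequence space `ℓ^q` of Fourier coefficients:
`(∑_j |a_j|^q ‖u_j‖_∞^{2-q})^{1/q}` for finite `q`, and `sup_j |a_j| ‖u_j‖_∞^{-1}` for
`q = ∞`. -/
noncomputable def ellNorm {n : ℕ} (u : ℕ → L2 n) (q : ℝ≥0∞) (a : ℕ → ℂ) : ℝ≥0∞ :=
  if q = ∞ then ⨆ j, ‖a j‖ₑ * (supNorm (u j))⁻¹
  else (∑' j, ‖a j‖ₑ ^ q.toReal * supNorm (u j) ^ (2 - q.toReal)) ^ (1 / q.toReal)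

end Anharmonic

/-!
*Eigenfunctions are bounded.* If `(-Δ)^l u + V u = c u`, test the equation against the heat kernel
of `(-Δ)^l + V y`, whose potential is frozen at the point `y` of evaluation. Parametrizing time as
`s^{2l}`, Duhamel's formula expresses `u y` as a bounded term from time `δ^{2l}` plus an integral
over `0 < s ≤ δ` of `u` against `(V y + c - V x)` times the kernel, with weight
`2l s^{2l-1} exp (-s^{2l} V y)`. The relative oscillation of `V` at distance `s` is `O(s)`, and the
exponential absorbs `s^{2l} V y`, so the integrand is dominated by dilates of one integrable
profile, uniformly in `y`. Hence `|u| ≤ C + K |u|` for a positive operator `K`, whose `L²` and `L^∞`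
norms are small if `δ` is small, and comparison with the constant `2C` gives `|u| ≤ 2C`.

*Hausdorff–Young.* By Bessel's inequality and the trivial bound `|∫ f conj(u_j)| ≤ ‖f‖₁ ‖u_j‖_∞`,
the estimate is an interpolation between `p = 2` and `p = 1`, done by the three lines theorem.
-/

open scoped NNReal

namespace Anharmonic

section HeatKernel

open Filter Topology Real LineDeriv
open scoped FourierTransform

/-- A smooth function on the line that is `exp (-s)` for `s ≥ 0` and `0` for `s ≤ -1`; composing it
with a nonnegative symbol `σ` exhibits `exp (-σ)` as a Schwartz function. -/
noncomputable def cutoffExp (s : ℝ) : ℂ := (smoothTransition (s + 1) * exp (-s) : ℝ)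

theorem cutoffExp_of_nonneg {s : ℝ} (hs : 0 ≤ s) : cutoffExp s = exp (-s) := by
  rw [cutoffExp, smoothTransition.one_of_one_le (by linarith), one_mul]

theorem cutoffExp_of_le {s : ℝ} (hs : s ≤ -1) : cutoffExp s = 0 := by
  rw [cutoffExp, smoothTransition.zero_of_nonpos (by linarith), zero_mul, Complex.ofReal_zero]

theorem contDiff_cutoffExp {m : ℕ∞} : ContDiff ℝ m cutoffExp :=
  Complex.ofRealCLM.contDiff.comp
    ((smoothTransition.contDiff.comp (contDiff_id.add contDiff_const)).mul
      (contDiff_exp.comp contDiff_neg))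

theorem iteratedDeriv_ofReal_exp_neg (m : ℕ) :
    iteratedDeriv m (fun s : ℝ ↦ (exp (-s) : ℂ)) = fun s : ℝ ↦ (-1) ^ m * (exp (-s) : ℂ) := by
  induction m with
  | zero => simp
  | succ m ih =>
    rw [iteratedDeriv_succ, ih]
    funext s
    have h : HasDerivAt (fun s : ℝ ↦ (exp (-s) : ℂ)) ((exp (-s) * -1 : ℝ) : ℂ) s :=
      ((hasDerivAt_neg s).exp).ofReal_comp
    rw [(h.const_mul _).deriv]
    push_cast
    ring

theorem exists_pow_mul_norm_iteratedFDeriv_cutoffExp_le (k m : ℕ) :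
    ∃ C : ℝ, ∀ s, ‖s‖ ^ k * ‖iteratedFDeriv ℝ m cutoffExp s‖ ≤ C := by
  have hcont : Continuous fun s : ℝ ↦ ‖s‖ ^ k * ‖iteratedFDeriv ℝ m cutoffExp s‖ :=
    (continuous_norm.pow k).mul
      ((contDiff_cutoffExp (m := m)).continuous_iteratedFDeriv le_rfl).norm
  obtain ⟨C, hC⟩ := (isCompact_Icc (a := (-1 : ℝ)) (b := 0)).bddAbove_image hcont.continuousOn
  refine ⟨max C k.factorial, fun s ↦ ?_⟩
  rcases lt_or_ge s (-1) with hs | hs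
  · have h : cutoffExp =ᶠ[𝓝 s] fun _ ↦ 0 :=
      (eventually_lt_nhds hs).mono fun t ht ↦ cutoffExp_of_le ht.le
    rw [norm_iteratedFDeriv_eq_norm_iteratedDeriv, h.iteratedDeriv_eq]
    simp
  rcases le_or_gt s 0 with hs0 | hs0
  · exact le_max_of_le_left (hC ⟨s, ⟨hs, hs0⟩, rfl⟩)
  · have h : cutoffExp =ᶠ[𝓝 s] fun s : ℝ ↦ (exp (-s) : ℂ) :=
      (eventually_gt_nhds hs0).mono fun t ht ↦ cutoffExp_of_nonneg ht.le
    refine le_max_of_le_right ?_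
    rw [norm_iteratedFDeriv_eq_norm_iteratedDeriv, h.iteratedDeriv_eq,
      iteratedDeriv_ofReal_exp_neg, norm_mul, norm_pow, norm_neg, norm_one, one_pow, one_mul,
      Complex.norm_real, norm_of_nonneg (exp_pos _).le, norm_of_nonneg hs0.le, exp_neg,
      ← div_eq_mul_inv, div_le_comm₀ (exp_pos s) (by positivity)]
    exact pow_div_factorial_le_exp s hs0.le k

variable {E : Type*} [NormedAddCommGroup E] {l : ℕ}

/-- The Fourier symbol `(2π‖ξ‖)^{2l}` of `(-Δ)^l`. -/
noncomputable def symbol (l : ℕ) (ξ : E) : ℝ := ((2 * π) ^ 2 * ‖ξ‖ ^ 2) ^ l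

theorem symbol_nonneg (l : ℕ) (ξ : E) : 0 ≤ symbol l ξ := by
  unfold symbol; positivity

theorem symbol_zero (ξ : E) : symbol 0 ξ = 1 := pow_zero _

theorem symbol_succ (l : ℕ) (ξ : E) :
    symbol (l + 1) ξ = (2 * π) ^ 2 * ‖ξ‖ ^ 2 * symbol l ξ := pow_succ' _ _

theorem norm_le_one_add_symbol [NeZero l] (ξ : E) : ‖ξ‖ ≤ 1 + symbol l ξ := by
  rcases le_or_gt ‖ξ‖ 1 with hξ | hξ
  · linarith [symbol_nonneg l ξ]
  · have h2π : 1 ≤ (2 * π) ^ 2 := one_le_pow₀ (by linarith [pi_gt_three])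
    have h : ‖ξ‖ ≤ (2 * π) ^ 2 * ‖ξ‖ ^ 2 := by nlinarith
    have hsymb : (2 * π) ^ 2 * ‖ξ‖ ^ 2 ≤ symbol l ξ :=
      le_self_pow₀ (hξ.le.trans h) (NeZero.ne l)
    linarith

variable [InnerProductSpace ℝ E]

@[fun_prop]
theorem symbol_hasTemperateGrowth (l : ℕ) : (symbol l : E → ℝ).HasTemperateGrowth := by
  unfold symbol; fun_prop

theorem hasFDerivAt_symbol (l : ℕ) (ξ : E) :
    ∃ L : E →L[ℝ] ℝ, HasFDerivAt (symbol l) L ξ ∧ L ξ = 2 * l * symbol l ξ := by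
  refine ⟨_, ((hasStrictFDerivAt_norm_sq ξ).hasFDerivAt.const_mul ((2 * π) ^ 2)).pow l, ?_⟩
  rcases l with _ | l
  · simp
  · simp only [symbol, smul_apply, innerSL_apply_apply, real_inner_self_eq_norm_sq, nsmul_eq_mul,
      smul_eq_mul, Nat.cast_add, Nat.cast_one, Nat.add_sub_cancel, Nat.cast_ofNat]
    ring

/-- The Schwartz function `exp (-(2π‖ξ‖)^{2l})`, the Fourier transform of the heat kernel of
`(-Δ)^l` at time one. -/
noncomputable def expNegSymbol (E : Type*) [NormedAddCommGroup E] [InnerProductSpace ℝ E] (l : ℕ)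
    [NeZero l] : 𝓢(E, ℂ) :=
  SchwartzMap.compCLM ℂ (symbol_hasTemperateGrowth l)
    ⟨1, 1, fun ξ ↦ by
      simpa [abs_of_nonneg (symbol_nonneg l ξ)] using norm_le_one_add_symbol (l := l) ξ⟩
    ⟨cutoffExp, contDiff_cutoffExp, exists_pow_mul_norm_iteratedFDeriv_cutoffExp_le⟩

theorem expNegSymbol_apply [NeZero l] (ξ : E) : expNegSymbol E l ξ = exp (-symbol l ξ) :=
  cutoffExp_of_nonneg (symbol_nonneg l ξ)

theorem fderiv_expNegSymbol_apply_self [NeZero l] (ξ : E) :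
    fderiv ℝ (expNegSymbol E l) ξ ξ = -(2 * l * (symbol l ξ * expNegSymbol E l ξ)) := by
  obtain ⟨L, hL, hLξ⟩ := hasFDerivAt_symbol l ξ
  have h : HasFDerivAt (expNegSymbol E l)
      (Complex.ofRealCLM ∘L (exp (-symbol l ξ) • -L)) ξ := by
    rw [show ⇑(expNegSymbol E l) = fun ξ ↦ (exp (-symbol l ξ) : ℂ) from
      funext expNegSymbol_apply]
    exact Complex.ofRealCLM.hasFDerivAt.comp ξ hL.neg.exp
  rw [h.fderiv, expNegSymbol_apply]
  simp only [ContinuousLinearMap.comp_apply, smul_apply, neg_apply, hLξ, smul_eq_mul,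
    Complex.ofRealCLM_apply]
  push_cast
  ring

theorem sum_lineDerivOp_smulLeftCLM_inner {ι : Type*} [Fintype ι] (b : OrthonormalBasis ι ℝ E)
    {f r : 𝓢(E, ℂ)} (hr : ∀ ξ, r ξ = fderiv ℝ f ξ ξ) :
    ∑ i, ∂_{b i} (SchwartzMap.smulLeftCLM ℂ (inner ℝ · (b i)) f) =
      (Fintype.card ι : ℂ) • f + r := by
  ext ξ
  have hterm (i : ι) : ∂_{b i} (SchwartzMap.smulLeftCLM ℂ (inner ℝ · (b i)) f) ξ =
      f ξ + fderiv ℝ f ξ (inner ℝ (b i) ξ • b i) := by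
    have h : HasFDerivAt (fun x ↦ inner ℝ (b i) x • f x) _ ξ :=
      (innerSL ℝ (b i)).hasFDerivAt.fun_smul (f.hasFDerivAt (x := ξ))
    have hmul : ⇑(SchwartzMap.smulLeftCLM ℂ (inner ℝ · (b i)) f) =
        fun x ↦ inner ℝ (b i) x • f x := by
      simp only [SchwartzMap.smulLeftCLM_apply (g := (inner ℝ · (b i))) (by fun_prop),
        real_inner_comm]
    rw [SchwartzMap.lineDerivOp_apply_eq_fderiv, hmul, h.fderiv]
    simp [add_comm, real_inner_comm]
  rw [sum_apply, Finset.sum_congr rfl fun i _ ↦ hterm i, Finset.sum_add_distrib,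
    ← map_sum (fderiv ℝ f ξ), b.sum_repr']
  simp [hr]

variable [FiniteDimensional ℝ E]

/-- `(-Δ)^l` on Schwartz functions. -/
noncomputable def polyLaplacian (l : ℕ) : 𝓢(E, ℂ) → 𝓢(E, ℂ) := (fun f ↦ -Δ f)^[l]

theorem polyLaplacian_succ (l : ℕ) (f : 𝓢(E, ℂ)) :
    polyLaplacian (l + 1) f = -Δ (polyLaplacian l f) :=
  Function.iterate_succ_apply' _ l f

variable [MeasurableSpace E] [BorelSpace E]

theorem polyLaplacian_fourierInv (l : ℕ) (f : 𝓢(E, ℂ)) :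
    polyLaplacian l (𝓕⁻ f) = 𝓕⁻ (SchwartzMap.smulLeftCLM ℂ (symbol l) f) := by
  induction l with
  | zero =>
    simp [polyLaplacian, funext symbol_zero]
  | succ l ih =>
    rw [polyLaplacian_succ, ih, SchwartzMap.laplacian_eq_fourierMultiplierCLM,
      SchwartzMap.fourierMultiplierCLM_apply, FourierTransform.fourier_fourierInv_eq, ← neg_smul,
      neg_neg, ← FourierTransform.fourierInv_smul]
    congr 1
    ext ξ
    rw [smul_apply, SchwartzMap.smulLeftCLM_apply_apply (by fun_prop),
      SchwartzMap.smulLeftCLM_apply_apply (by fun_prop),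
      SchwartzMap.smulLeftCLM_apply_apply (by fun_prop), symbol_succ]
    simp only [smul_smul, mul_assoc]

/-- The heat kernel of `(-Δ)^l` at time one. -/
noncomputable def heatKernel (E : Type*) [NormedAddCommGroup E] [InnerProductSpace ℝ E]
    [FiniteDimensional ℝ E] [MeasurableSpace E] [BorelSpace E] (l : ℕ) [NeZero l] : 𝓢(E, ℂ) :=
  𝓕⁻ (expNegSymbol E l)

theorem integral_heatKernel [NeZero l] : ∫ x, heatKernel E l x = 1 := by
  have h : 𝓕 (heatKernel E l) = expNegSymbol E l := FourierTransform.fourier_fourierInv_eq _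
  have h0 := DFunLike.congr_fun h 0
  rw [SchwartzMap.fourier_coe, Real.fourier_eq', expNegSymbol_apply] at h0
  simpa [symbol, NeZero.ne l] using h0

theorem inner_mul_lineDerivOp_fourierInv (f : 𝓢(E, ℂ)) (m x : E) :
    (inner ℝ x m : ℂ) * ∂_{m} (𝓕⁻ f) x =
      -(𝓕⁻ (∂_{m} (SchwartzMap.smulLeftCLM ℂ (inner ℝ · m) f)) : 𝓢(E, ℂ)) x := by
  rw [SchwartzMap.lineDerivOp_fourierInv_eq, SchwartzMap.fourierInv_lineDerivOp_eq,
    FourierTransform.fourierInv_smul]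
  simp only [smul_apply, SchwartzMap.smulLeftCLM_apply_apply (g := (inner ℝ · m)) (by fun_prop),
    Complex.real_smul, smul_eq_mul]
  ring

/-- Euler's operator `x · ∇` corresponds under the Fourier transform to `-(n + ξ · ∇)`. -/
theorem finrank_mul_fourierInv_add_fderiv {f r : 𝓢(E, ℂ)} (hr : ∀ ξ, r ξ = fderiv ℝ f ξ ξ)
    (x : E) : Module.finrank ℝ E * (𝓕⁻ f : 𝓢(E, ℂ)) x + fderiv ℝ (𝓕⁻ f : 𝓢(E, ℂ)) x x =
      -(𝓕⁻ r : 𝓢(E, ℂ)) x := by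
  let b := stdOrthonormalBasis ℝ E
  have hx : fderiv ℝ (𝓕⁻ f : 𝓢(E, ℂ)) x x =
      ∑ i, (inner ℝ x (b i) : ℂ) * ∂_{b i} (𝓕⁻ f) x := by
    calc fderiv ℝ (𝓕⁻ f : 𝓢(E, ℂ)) x x
      _ = fderiv ℝ (𝓕⁻ f : 𝓢(E, ℂ)) x (∑ i, inner ℝ (b i) x • b i) := by rw [b.sum_repr']
      _ = ∑ i, (inner ℝ x (b i) : ℂ) * ∂_{b i} (𝓕⁻ f) x := by
        simp [SchwartzMap.lineDerivOp_apply_eq_fderiv, real_inner_comm]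
  have hsum : ∑ i, (𝓕⁻ (∂_{b i} (SchwartzMap.smulLeftCLM ℂ (inner ℝ · (b i)) f)) : 𝓢(E, ℂ)) x =
      Module.finrank ℝ E * (𝓕⁻ f : 𝓢(E, ℂ)) x + (𝓕⁻ r : 𝓢(E, ℂ)) x := by
    rw [← sum_apply, ← FourierTransform.fourierInv_sum, sum_lineDerivOp_smulLeftCLM_inner b hr,
      FourierTransform.fourierInv_add, FourierTransform.fourierInv_smul]
    simp
  rw [hx, Finset.sum_congr rfl fun i _ ↦ inner_mul_lineDerivOp_fourierInv f (b i) x,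
    Finset.sum_neg_distrib, hsum]
  ring

theorem finrank_mul_heatKernel_add_fderiv [NeZero l] (x : E) :
    Module.finrank ℝ E * heatKernel E l x + fderiv ℝ (heatKernel E l) x x =
      2 * l * polyLaplacian l (heatKernel E l) x := by
  rw [heatKernel, polyLaplacian_fourierInv, finrank_mul_fourierInv_add_fderiv
    (r := -(2 * l : ℂ) • SchwartzMap.smulLeftCLM ℂ (symbol l) (expNegSymbol E l)),
    FourierTransform.fourierInv_smul]
  · simp
  · intro ξ
    rw [fderiv_expNegSymbol_apply_self, smul_apply,
      SchwartzMap.smulLeftCLM_apply_apply (by fun_prop)]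
    simp

end HeatKernel

section Dilate

open Module (finrank)

variable {E F : Type*} [NormedAddCommGroup E] [NormedSpace ℝ E] [NormedAddCommGroup F]
  [NormedSpace ℝ F]

/-- The dilate of `g` to width `s` centred at `y`, normalized so as to have the same integral. -/
noncomputable def dilate (g : E → F) (s : ℝ) (y x : E) : F :=
  (s ^ finrank ℝ E)⁻¹ • g (s⁻¹ • (x - y))

theorem norm_dilate_le {g : E → F} {d : E → ℝ} {C s : ℝ} (h : ∀ w, ‖g w‖ ≤ C * d w) (hs : 0 < s)
    (y x : E) : ‖dilate g s y x‖ ≤ C * dilate d s y x := by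
  rw [dilate, dilate, norm_smul, Real.norm_of_nonneg (by positivity), smul_eq_mul, mul_left_comm]
  gcongr
  exact h _

theorem hasDerivAt_dilate {g : E → F} (hg : Differentiable ℝ g) {s : ℝ} (hs : 0 < s) (y x : E) :
    HasDerivAt (fun s ↦ dilate g s y x)
      (-s⁻¹ • dilate (fun w ↦ finrank ℝ E • g w + fderiv ℝ g w w) s y x) s := by
  have hpow : HasDerivAt (fun s : ℝ ↦ (s ^ finrank ℝ E)⁻¹)
      (-s⁻¹ * (finrank ℝ E * (s ^ finrank ℝ E)⁻¹)) s := by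
    refine ((hasDerivAt_pow _ s).fun_inv (pow_ne_zero _ hs.ne')).congr_deriv ?_
    rcases finrank ℝ E with _ | n
    · simp
    · simp only [Nat.add_sub_cancel]
      field_simp
      ring
  have hinv : HasDerivAt (fun s : ℝ ↦ s⁻¹ • (x - y)) (-s⁻¹ • s⁻¹ • (x - y)) s := by
    refine ((hasDerivAt_inv hs.ne').smul_const (x - y)).congr_deriv ?_
    rw [smul_smul, neg_mul, ← sq, inv_pow]
  refine (hpow.smul ((hg _).hasFDerivAt.comp_hasDerivAt s hinv)).congr_deriv ?_
  simp only [dilate, map_smul, smul_add, ← Nat.cast_smul_eq_nsmul ℝ, smul_smul]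
  rw [add_comm]
  congr 2 <;> ring

theorem continuousOn_dilate {g : E → F} (hg : Continuous g) (y x : E) :
    ContinuousOn (fun s ↦ dilate g s y x) (Set.Ioi 0) := by
  have h : ∀ s ∈ Set.Ioi (0 : ℝ), s ^ finrank ℝ E ≠ 0 := fun s hs ↦ pow_ne_zero _ hs.ne'
  have hinv : ContinuousOn (fun s : ℝ ↦ s⁻¹) (Set.Ioi 0) :=
    continuousOn_inv₀.mono fun s hs ↦ hs.ne'
  exact ((continuousOn_pow _).inv₀ h).smul
    (hg.comp_continuousOn (hinv.smul continuousOn_const))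

/-- A profile whose dilates dominate those of every Schwartz function. -/
noncomputable def decay (w : E) : ℝ := ((1 + ‖w‖) ^ (finrank ℝ E + 1))⁻¹

theorem decay_nonneg (w : E) : 0 ≤ decay w := by
  unfold decay; positivity

theorem continuous_decay : Continuous (decay : E → ℝ) := by
  unfold decay
  exact Continuous.inv₀ (by fun_prop) fun w ↦ by positivity

theorem dilate_decay_nonneg {s : ℝ} (hs : 0 < s) (y x : E) : 0 ≤ dilate decay s y x :=
  smul_nonneg (by positivity) (decay_nonneg _)

theorem dilate_decay_comm (s : ℝ) (y x : E) : dilate decay s y x = dilate decay s x y := by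
  simp only [dilate, decay, norm_smul, norm_sub_rev x y]

theorem dilate_decay_le {ε s : ℝ} (hε : 0 < ε) (hεs : ε ≤ s) (hs : s ≤ 1) (y x : E) :
    dilate decay s y x ≤ (ε ^ finrank ℝ E)⁻¹ * decay (x - y) := by
  have hs0 : 0 < s := hε.trans_le hεs
  have hnorm : ‖x - y‖ ≤ ‖s⁻¹ • (x - y)‖ := by
    rw [norm_smul, Real.norm_of_nonneg (by positivity)]
    exact le_mul_of_one_le_left (norm_nonneg _) ((one_le_inv₀ hs0).2 hs)
  unfold dilate decay
  rw [smul_eq_mul]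
  gcongr

theorem exists_one_add_norm_pow_mul_le (f : 𝓢(E, F)) (m : ℕ) :
    ∃ C : ℝ, 0 ≤ C ∧ ∀ w, (1 + ‖w‖) ^ m * ‖f w‖ ≤ C * decay w := by
  refine ⟨2 ^ (m + (finrank ℝ E + 1)) * (Finset.Iic (m + (finrank ℝ E + 1), 0)).sup
    (fun m ↦ SchwartzMap.seminorm ℝ m.1 m.2) f, by positivity, fun w ↦ ?_⟩
  rw [decay, ← div_eq_mul_inv, le_div_iff₀ (by positivity), mul_right_comm, ← pow_add]
  simpa using f.one_add_le_sup_seminorm_apply (𝕜 := ℝ) (m := (m + (finrank ℝ E + 1), 0))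
    le_rfl le_rfl w

theorem exists_norm_le_mul_decay (f : 𝓢(E, F)) :
    ∃ C : ℝ, 0 ≤ C ∧ ∀ w, ‖f w‖ ≤ C * decay w := by
  simpa using exists_one_add_norm_pow_mul_le f 0

variable [FiniteDimensional ℝ E] [MeasurableSpace E] [BorelSpace E]

theorem measurable_dilate [MeasurableSpace F] [BorelSpace F] [SecondCountableTopology F]
    {X : Type*} [MeasurableSpace X] {g : E → F} (hg : Measurable g) {s : X → ℝ} (hs : Measurable s)
    {y x : X → E} (hy : Measurable y) (hx : Measurable x) :
    Measurable fun p ↦ dilate g (s p) (y p) (x p) :=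
  (hs.pow_const _).inv.smul (hg.comp (hs.inv.smul (hx.sub hy)))

variable {μ : Measure E} [μ.IsAddHaarMeasure]

theorem integral_dilate (g : E → F) {s : ℝ} (hs : 0 < s) (y : E) :
    ∫ x, dilate g s y x ∂μ = ∫ w, g w ∂μ := by
  unfold dilate
  rw [integral_sub_right_eq_self fun x ↦ (s ^ finrank ℝ E)⁻¹ • g (s⁻¹ • x), integral_smul,
    Measure.integral_comp_inv_smul_of_nonneg μ g hs.le, smul_smul,
    inv_mul_cancel₀ (by positivity), one_smul]

theorem integrable_dilate {g : E → F} (hg : Integrable g μ) {s : ℝ} (hs : 0 < s) (y : E) :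
    Integrable (dilate g s y) μ :=
  ((hg.comp_smul (inv_ne_zero hs.ne')).comp_sub_right y).smul _

theorem integral_mul_dilate (u g : E → ℂ) {s : ℝ} (hs : 0 < s) (y : E) :
    ∫ x, u x * dilate g s y x ∂μ = ∫ w, u (y + s • w) * g w ∂μ := by
  rw [← integral_dilate (fun w ↦ u (y + s • w) * g w) hs y]
  simp only [dilate, smul_inv_smul₀ hs.ne', add_sub_cancel, mul_smul_comm]

theorem integrable_decay : Integrable (decay : E → ℝ) μ := by
  refine (integrable_one_add_norm (r := (finrank ℝ E + 1 : ℕ)) (by simp)).congr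
    (ae_of_all _ fun w ↦ ?_)
  simp only [decay, Real.rpow_neg (add_nonneg zero_le_one (norm_nonneg w)), Real.rpow_natCast]

theorem lintegral_dilate_decay {s : ℝ} (hs : 0 < s) (y : E) :
    ∫⁻ x, ENNReal.ofReal (dilate decay s y x) ∂μ = ∫⁻ w, ENNReal.ofReal (decay w) ∂μ := by
  rw [← ofReal_integral_eq_lintegral_ofReal (integrable_dilate integrable_decay hs y)
    (ae_of_all _ (dilate_decay_nonneg hs y)), integral_dilate decay hs,
    ofReal_integral_eq_lintegral_ofReal integrable_decay (ae_of_all _ decay_nonneg)]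

end Dilate

section FrozenHeatKernel

open Module (finrank)
open Real LineDeriv

variable {E : Type*} [NormedAddCommGroup E] [InnerProductSpace ℝ E] {l : ℕ}

/-- `dilate f s y` as a Schwartz function. -/
noncomputable def schwartzDilate (f : 𝓢(E, ℂ)) {s : ℝ} (hs : s ≠ 0) (y : E) : 𝓢(E, ℂ) :=
  (s ^ finrank ℝ E)⁻¹ • SchwartzMap.compSubConstCLM ℂ y
    (SchwartzMap.compCLMOfContinuousLinearEquiv ℂ
      (ContinuousLinearEquiv.smulLeft (Units.mk0 s⁻¹ (inv_ne_zero hs))) f)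

theorem coe_schwartzDilate (f : 𝓢(E, ℂ)) {s : ℝ} (hs : s ≠ 0) (y : E) :
    ⇑(schwartzDilate f hs y) = dilate f s y :=
  rfl

theorem lineDerivOp_schwartzDilate (m : E) (f : 𝓢(E, ℂ)) {s : ℝ} (hs : s ≠ 0) (y : E) :
    ∂_{m} (schwartzDilate f hs y) = s⁻¹ • schwartzDilate (∂_{m} f) hs y := by
  ext x
  have hinner : HasFDerivAt (fun x ↦ s⁻¹ • (x - y)) (s⁻¹ • ContinuousLinearMap.id ℝ E) x :=
    ((hasFDerivAt_id x).sub_const y).const_smul s⁻¹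
  have h : HasFDerivAt (dilate f s y) _ x :=
    ((f.hasFDerivAt (x := s⁻¹ • (x - y))).comp x hinner).const_smul (s ^ finrank ℝ E)⁻¹
  rw [SchwartzMap.lineDerivOp_apply_eq_fderiv, coe_schwartzDilate, h.fderiv, smul_apply,
    smul_apply, coe_schwartzDilate, dilate, SchwartzMap.lineDerivOp_apply_eq_fderiv]
  simp [mul_left_comm]

variable [FiniteDimensional ℝ E]

theorem laplacian_schwartzDilate (f : 𝓢(E, ℂ)) {s : ℝ} (hs : s ≠ 0) (y : E) :
    Δ (schwartzDilate f hs y) = (s ^ 2)⁻¹ • schwartzDilate (Δ f) hs y := by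
  rw [SchwartzMap.laplacian_eq_sum (stdOrthonormalBasis ℝ E),
    SchwartzMap.laplacian_eq_sum (stdOrthonormalBasis ℝ E)]
  simp only [lineDerivOp_schwartzDilate, lineDerivOp_smul]
  ext x
  simp only [sum_apply, smul_apply, coe_schwartzDilate, dilate, Finset.smul_sum, smul_smul]
  refine Finset.sum_congr rfl fun i _ ↦ ?_
  congr 1
  ring

theorem polyLaplacian_schwartzDilate (l : ℕ) (f : 𝓢(E, ℂ)) {s : ℝ} (hs : s ≠ 0) (y : E) :
    polyLaplacian l (schwartzDilate f hs y) =
      (s ^ (2 * l))⁻¹ • schwartzDilate (polyLaplacian l f) hs y := by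
  induction l with
  | zero => simp [polyLaplacian]
  | succ l ih =>
    have hsmul (a : ℝ) (w : 𝓢(E, ℂ)) : Δ (a • w) = a • Δ w := by
      simp only [← SchwartzMap.laplacianCLM_eq (𝕜 := ℝ), map_smul]
    rw [polyLaplacian_succ, polyLaplacian_succ, ih, hsmul, laplacian_schwartzDilate]
    ext x
    simp only [neg_apply, smul_apply, coe_schwartzDilate, dilate, smul_smul, smul_neg, mul_add,
      pow_add, mul_inv, mul_one]

variable [MeasurableSpace E] [BorelSpace E]

theorem hasDerivAt_dilate_heatKernel [NeZero l] {s : ℝ} (hs : 0 < s) (y x : E) :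
    HasDerivAt (fun s ↦ dilate (heatKernel E l) s y x)
      (-s⁻¹ • (2 * l : ℝ) • dilate (polyLaplacian l (heatKernel E l)) s y x) s := by
  refine (hasDerivAt_dilate (heatKernel E l).differentiable hs y x).congr_deriv ?_
  simp only [dilate, nsmul_eq_mul, finrank_mul_heatKernel_add_fderiv, Complex.real_smul]
  push_cast
  ring

/-- The rate `-∂ₛ exp (-s^{2l} a) / a` at which the factor `exp (-s^{2l} a)` decays. -/
noncomputable def dampingRate (l : ℕ) (a s : ℝ) : ℝ :=
  2 * l * s ^ (2 * l - 1) * exp (-(s ^ (2 * l) * a))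

/-- The heat kernel of `(-Δ)^l + a` at time `s^{2l}`, centred at `y`. -/
noncomputable def frozenHeatKernel (l : ℕ) [NeZero l] (a s : ℝ) (y x : E) : ℂ :=
  exp (-(s ^ (2 * l) * a)) • dilate (heatKernel E l) s y x

/-- The derivative of `frozenHeatKernel` in `s`. -/
noncomputable def frozenHeatKernelDeriv (l : ℕ) [NeZero l] (a s : ℝ) (y x : E) : ℂ :=
  -dampingRate l a s • (a • dilate (heatKernel E l) s y x +
    (s ^ (2 * l))⁻¹ • dilate (polyLaplacian l (heatKernel E l)) s y x)

theorem hasDerivAt_frozenHeatKernel [NeZero l] (a : ℝ) {s : ℝ} (hs : 0 < s) (y x : E) :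
    HasDerivAt (fun s ↦ frozenHeatKernel l a s y x) (frozenHeatKernelDeriv l a s y x) s := by
  have hexp : HasDerivAt (fun s ↦ exp (-(s ^ (2 * l) * a))) (-(dampingRate l a s * a)) s := by
    refine ((hasDerivAt_pow (2 * l) s).mul_const a).fun_neg.exp.congr_deriv ?_
    rw [dampingRate]
    push_cast
    ring
  refine (hexp.smul (hasDerivAt_dilate_heatKernel hs y x)).congr_deriv ?_
  have hrate : exp (-(s ^ (2 * l) * a)) * (s⁻¹ * (2 * l)) =
      dampingRate l a s * (s ^ (2 * l))⁻¹ := by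
    rw [dampingRate, ← pow_sub_one_mul (mul_ne_zero two_ne_zero (NeZero.ne l)) s]
    field_simp
  simp only [frozenHeatKernelDeriv, smul_add, smul_smul, neg_mul, mul_neg, hrate]
  rw [add_comm]

theorem measurable_frozenHeatKernelDeriv [NeZero l] (a : ℝ) (y : E) :
    Measurable fun p : E × ℝ ↦ frozenHeatKernelDeriv l a p.2 y p.1 := by
  have hdilate (f : 𝓢(E, ℂ)) : Measurable fun p : E × ℝ ↦ dilate f p.2 y p.1 :=
    measurable_dilate f.continuous.measurable measurable_snd measurable_const measurable_fst
  unfold frozenHeatKernelDeriv dampingRate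
  fun_prop

theorem continuousOn_frozenHeatKernelDeriv [NeZero l] (a : ℝ) (y x : E) :
    ContinuousOn (fun s ↦ frozenHeatKernelDeriv l a s y x) (Set.Ioi 0) := by
  have h₁ := continuousOn_dilate (heatKernel E l).continuous y x
  have h₂ := continuousOn_dilate (polyLaplacian l (heatKernel E l)).continuous y x
  have h₃ : ContinuousOn (fun s : ℝ ↦ (s ^ (2 * l))⁻¹) (Set.Ioi 0) :=
    (continuousOn_pow _).inv₀ fun s hs ↦ pow_ne_zero _ hs.ne'
  have h₄ : ContinuousOn (dampingRate l a) (Set.Ioi 0) := by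
    unfold dampingRate; fun_prop
  exact h₄.neg.smul ((h₁.const_smul a).add (h₃.smul h₂))

theorem integral_frozenHeatKernelDeriv [NeZero l] (a : ℝ) {ε δ : ℝ} (hε : 0 < ε) (hεδ : ε ≤ δ)
    (y x : E) : ∫ s in Set.Ioc ε δ, frozenHeatKernelDeriv l a s y x =
      frozenHeatKernel l a δ y x - frozenHeatKernel l a ε y x := by
  have hsub : Set.uIcc ε δ ⊆ Set.Ioi 0 := fun s hs ↦ hε.trans_le (Set.uIcc_of_le hεδ ▸ hs).1
  rw [← intervalIntegral.integral_of_le hεδ]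
  exact intervalIntegral.integral_eq_sub_of_hasDerivAt
    (fun s hs ↦ hasDerivAt_frozenHeatKernel a (hsub hs) y x)
    ((continuousOn_frozenHeatKernelDeriv a y x).mono hsub).intervalIntegrable

end FrozenHeatKernel

section WeakSolution

open Real

variable {E : Type*} [NormedAddCommGroup E] [InnerProductSpace ℝ E] {V : E → ℝ} {l : ℕ}

/-- A nonnegative potential with polynomially bounded relative oscillation, as needed to compare
it with its value at a fixed point. -/
structure IsSlowlyVarying (V : E → ℝ) : Prop where
  nonneg : ∀ x, 0 ≤ V x
  hasTemperateGrowth : V.HasTemperateGrowth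
  exists_abs_sub_le : ∃ A ≥ 0, ∃ m : ℕ, ∀ x y,
    |V x - V y| ≤ A * ‖x - y‖ * (1 + ‖x - y‖) ^ m * (1 + V y)

theorem one_add_mul_exp_neg_le {t a : ℝ} (ht : t ≤ 1) (ha : 0 ≤ t * a) :
    t * ((1 + a) * exp (-(t * a))) ≤ 2 := by
  have hexp : exp (-(t * a)) ≤ 1 := exp_le_one_iff.2 (neg_nonpos.2 ha)
  have hmul : t * a * exp (-(t * a)) ≤ 1 := by
    rw [exp_neg, ← div_eq_mul_inv, div_le_one (exp_pos _)]
    linarith [add_one_le_exp (t * a)]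
  nlinarith [exp_pos (-(t * a))]

theorem dampingRate_nonneg {s : ℝ} (hs : 0 ≤ s) (l : ℕ) (a : ℝ) : 0 ≤ dampingRate l a s := by
  unfold dampingRate; positivity

theorem dampingRate_le {a s : ℝ} (ha : 0 ≤ a) (hs : 0 ≤ s) (hs1 : s ≤ 1) (l : ℕ) :
    dampingRate l a s ≤ 2 * l := by
  have hexp : exp (-(s ^ (2 * l) * a)) ≤ 1 := exp_le_one_iff.2 (neg_nonpos.2 (by positivity))
  calc dampingRate l a s ≤ 2 * l * 1 * 1 := by
        unfold dampingRate
        gcongr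
        exact pow_le_one₀ hs hs1
    _ = 2 * l := by ring

theorem mul_one_add_mul_dampingRate_le {a s : ℝ} (ha : 0 ≤ a) (hs : 0 ≤ s) (hs1 : s ≤ 1) (l : ℕ)
    [NeZero l] : s * ((1 + a) * dampingRate l a s) ≤ 4 * l := by
  calc s * ((1 + a) * dampingRate l a s)
      = 2 * l * (s ^ (2 * l) * ((1 + a) * exp (-(s ^ (2 * l) * a)))) := by
        rw [dampingRate, ← pow_sub_one_mul (mul_ne_zero two_ne_zero (NeZero.ne l)) s]
        ring
    _ ≤ 2 * l * 2 := by
        gcongr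
        exact one_add_mul_exp_neg_le (pow_le_one₀ hs hs1) (by positivity)
    _ = 4 * l := by ring

theorem dampingRate_mul_oscillation_le {a s r A b : ℝ} (ha : 0 ≤ a) (hs : 0 ≤ s) (hs1 : s ≤ 1)
    (hr : 0 ≤ r) (hA : 0 ≤ A) (hb : 0 ≤ b) (l m : ℕ) [NeZero l] :
    dampingRate l a s * (A * (s * r) * (1 + s * r) ^ m * (1 + a) + b) ≤
      (4 * l * A + 2 * l * b) * (1 + r) ^ (m + 1) := by
  have hsr : s * r ≤ r := mul_le_of_le_one_left hr hs1
  have hosc : r * (1 + s * r) ^ m ≤ (1 + r) ^ (m + 1) := by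
    rw [pow_succ']
    gcongr
    linarith
  have hone : 1 ≤ (1 + r) ^ (m + 1) := one_le_pow₀ (by linarith)
  calc dampingRate l a s * (A * (s * r) * (1 + s * r) ^ m * (1 + a) + b)
      = s * ((1 + a) * dampingRate l a s) * A * (r * (1 + s * r) ^ m) +
          dampingRate l a s * b * 1 := by ring
    _ ≤ 4 * l * A * (1 + r) ^ (m + 1) + 2 * l * b * (1 + r) ^ (m + 1) := by
        gcongr ?_ * A * ?_ + ?_ * b * ?_
        · exact mul_one_add_mul_dampingRate_le ha hs hs1 l
        · exact dampingRate_le ha hs hs1 l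
    _ = (4 * l * A + 2 * l * b) * (1 + r) ^ (m + 1) := by ring

theorem one_add_norm_pow_mul_norm_dilate (g : E → ℂ) (m : ℕ) (s : ℝ) (y x : E) :
    (1 + ‖s⁻¹ • (x - y)‖) ^ m * ‖dilate g s y x‖ =
      ‖dilate (fun w ↦ (1 + ‖w‖) ^ m • g w) s y x‖ := by
  simp only [dilate]
  generalize s⁻¹ • (x - y) = w
  rw [norm_smul, norm_smul, norm_smul, norm_pow, Real.norm_of_nonneg (by positivity : 0 ≤ 1 + ‖w‖),
    mul_left_comm]

variable [FiniteDimensional ℝ E] [MeasurableSpace E] [BorelSpace E]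

theorem IsSlowlyVarying.exists_norm_error_le (hV : IsSlowlyVarying V) (l : ℕ) [NeZero l] (c : ℂ) :
    ∃ B : ℝ, 0 ≤ B ∧ ∀ s, 0 < s → s ≤ 1 → ∀ x y,
      ‖-dampingRate l (V y) s • ((V y + c - V x) * dilate (heatKernel E l) s y x)‖ ≤
        B * dilate decay s y x := by
  obtain ⟨A, hA, m, hosc⟩ := hV.exists_abs_sub_le
  obtain ⟨C, hC, hK⟩ := exists_one_add_norm_pow_mul_le (heatKernel E l) (m + 1)
  refine ⟨(4 * l * A + 2 * l * ‖c‖) * C, by positivity, fun s hs hs1 x y ↦ ?_⟩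
  have hnorm : ‖x - y‖ = s * ‖s⁻¹ • (x - y)‖ := by
    rw [norm_smul, norm_inv, Real.norm_of_nonneg hs.le, mul_inv_cancel_left₀ hs.ne']
  have hsub : ‖(V y + c - V x : ℂ)‖ ≤ A * ‖x - y‖ * (1 + ‖x - y‖) ^ m * (1 + V y) + ‖c‖ := by
    have h : (V y + c - V x : ℂ) = c - (V x - V y : ℝ) := by push_cast; ring
    rw [h, add_comm]
    refine (norm_sub_le _ _).trans (add_le_add_right ?_ _)
    rw [Complex.norm_real, Real.norm_eq_abs]
    exact hosc x y
  have hdilate : (1 + ‖s⁻¹ • (x - y)‖) ^ (m + 1) * ‖dilate (heatKernel E l) s y x‖ ≤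
      C * dilate decay s y x := by
    rw [one_add_norm_pow_mul_norm_dilate]
    refine norm_dilate_le (fun w ↦ ?_) hs y x
    rw [norm_smul, Real.norm_of_nonneg (by positivity)]
    exact hK w
  have hrate := dampingRate_nonneg hs.le l (V y)
  rw [norm_smul, norm_neg, Real.norm_of_nonneg hrate, norm_mul]
  calc dampingRate l (V y) s * (‖(V y + c - V x : ℂ)‖ * ‖dilate (heatKernel E l) s y x‖)
      ≤ dampingRate l (V y) s * (A * ‖x - y‖ * (1 + ‖x - y‖) ^ m * (1 + V y) + ‖c‖) *
          ‖dilate (heatKernel E l) s y x‖ := by rw [mul_assoc]; gcongr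
    _ ≤ (4 * l * A + 2 * l * ‖c‖) * (1 + ‖s⁻¹ • (x - y)‖) ^ (m + 1) *
          ‖dilate (heatKernel E l) s y x‖ := by
        rw [hnorm]
        refine mul_le_mul_of_nonneg_right ?_ (norm_nonneg _)
        exact dampingRate_mul_oscillation_le (hV.nonneg y) hs.le hs1
          (norm_nonneg (s⁻¹ • (x - y))) hA (norm_nonneg c) l m
    _ ≤ (4 * l * A + 2 * l * ‖c‖) * C * dilate decay s y x := by
        rw [mul_assoc, mul_assoc (4 * l * A + 2 * l * ‖c‖)]
        gcongr

/-- `u` solves `(-Δ)^l u + V u = c u` in the sense of tempered distributions. -/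
def IsWeakSolution (V : E → ℝ) (l : ℕ) (u : E → ℂ) (c : ℂ) : Prop :=
  ∀ φ : 𝓢(E, ℂ), ∫ x, u x * polyLaplacian l φ x = ∫ x, u x * ((c - V x) * φ x)

variable {u : E → ℂ} {c : ℂ}

theorem IsWeakSolution.integral_frozenHeatKernelDeriv [NeZero l] (h : IsWeakSolution V l u c)
    (hV : V.HasTemperateGrowth) (hu : MemLp u 2) (a : ℝ) {s : ℝ} (hs : 0 < s) (y : E) :
    ∫ x, u x * frozenHeatKernelDeriv l a s y x =
      ∫ x, u x * (-dampingRate l a s • ((a + c - V x) * dilate (heatKernel E l) s y x)) := by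
  set φ := schwartzDilate (heatKernel E l) hs.ne' y with hφ
  have hint (ψ : 𝓢(E, ℂ)) : Integrable fun x ↦ u x * ψ x := hu.integrable_mul (ψ.memLp 2)
  have hVφ (x : E) : (c - V x) * φ x = (c • φ - SchwartzMap.smulLeftCLM ℂ V φ) x := by
    rw [sub_apply, smul_apply, SchwartzMap.smulLeftCLM_apply_apply hV, Complex.real_smul,
      smul_eq_mul, sub_mul]
  have hderiv (x : E) : u x * frozenHeatKernelDeriv l a s y x =
      -dampingRate l a s • (a • (u x * φ x) + u x * polyLaplacian l φ x) := by
    rw [hφ, polyLaplacian_schwartzDilate, smul_apply, coe_schwartzDilate, coe_schwartzDilate,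
      frozenHeatKernelDeriv, mul_smul_comm, mul_add, mul_smul_comm]
  have herror (x : E) :
      u x * (-dampingRate l a s • ((a + c - V x) * dilate (heatKernel E l) s y x)) =
        -dampingRate l a s • (a • (u x * φ x) + u x * ((c - V x) * φ x)) := by
    rw [mul_smul_comm, ← coe_schwartzDilate _ hs.ne', ← hφ, Complex.real_smul (x := a)]
    congr 1
    ring
  have hVint : Integrable fun x ↦ u x * ((c - V x) * φ x) := by
    simpa only [hVφ] using hint _
  have haφ : Integrable fun x ↦ a • (u x * φ x) := (hint φ).smul a
  simp only [hderiv, herror]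
  rw [integral_smul, integral_smul, integral_add haφ (hint _), integral_add haφ hVint, h φ]

end WeakSolution

section Duhamel

open Real

variable {E : Type*} [NormedAddCommGroup E] [InnerProductSpace ℝ E] [FiniteDimensional ℝ E]
  [MeasurableSpace E] [BorelSpace E] {V : E → ℝ} {l : ℕ} {u : E → ℂ} {c : ℂ}

theorem enorm_integral_mul_le {α : Type*} [MeasurableSpace α] {μ : Measure α} {p q : ℝ≥0∞}
    [p.HolderConjugate q] {f g : α → ℂ} (hf : AEStronglyMeasurable f μ)
    (hg : AEStronglyMeasurable g μ) :
    ‖∫ x, f x * g x ∂μ‖ₑ ≤ eLpNorm f p μ * eLpNorm g q μ :=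
  calc ‖∫ x, f x * g x ∂μ‖ₑ ≤ ∫⁻ x, ‖f x * g x‖ₑ ∂μ := enorm_integral_le_lintegral_enorm _
    _ = eLpNorm (f • g) 1 μ := (eLpNorm_one_eq_lintegral_enorm).symm
    _ ≤ eLpNorm f p μ * eLpNorm g q μ := eLpNorm_smul_le_mul_eLpNorm hg hf

theorem eLpNorm_dilate_eq (g : 𝓢(E, ℂ)) (s : ℝ) (y : E) (p : ℝ≥0∞) :
    eLpNorm (dilate g s y) p = eLpNorm (dilate g s 0) p := by
  have hg : Continuous (dilate g s 0) := by
    unfold dilate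
    exact (g.continuous.comp (by fun_prop)).const_smul _
  rw [← eLpNorm_comp_measurePreserving hg.aestronglyMeasurable
    (measurePreserving_sub_right volume y)]
  simp only [Function.comp_def, dilate, sub_zero]
  rfl

theorem memLp_dilate (f : 𝓢(E, ℂ)) {s : ℝ} (hs : 0 < s) (y : E) (p : ℝ≥0∞) :
    MemLp (dilate f s y) p := by
  rw [← coe_schwartzDilate f hs.ne' y]
  exact (schwartzDilate f hs.ne' y).memLp p

theorem memLp_two_decay : MemLp (decay : E → ℝ) 2 := by
  refine (memLp_two_iff_integrable_sq continuous_decay.aestronglyMeasurable).2 ?_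
  refine integrable_decay.mono' (continuous_decay.pow 2).aestronglyMeasurable
    (ae_of_all _ fun w ↦ ?_)
  have hle : decay w ≤ 1 := inv_le_one_of_one_le₀ (one_le_pow₀ (by simp))
  rw [Real.norm_of_nonneg (sq_nonneg _), sq]
  exact mul_le_of_le_one_left (decay_nonneg w) hle

theorem exists_norm_frozenHeatKernelDeriv_le [NeZero l] {a ε : ℝ} (ha : 0 ≤ a) (hε : 0 < ε) :
    ∃ C : ℝ, ∀ s, ε ≤ s → s ≤ 1 → ∀ y x : E,
      ‖frozenHeatKernelDeriv l a s y x‖ ≤ C * decay (x - y) := by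
  obtain ⟨A, hA, hK⟩ := exists_norm_le_mul_decay (heatKernel E l)
  obtain ⟨B, hB, hL⟩ := exists_norm_le_mul_decay (polyLaplacian l (heatKernel E l))
  refine ⟨2 * l * ((a * A + (ε ^ (2 * l))⁻¹ * B) * (ε ^ Module.finrank ℝ E)⁻¹),
    fun s hεs hs y x ↦ ?_⟩
  have hs0 : 0 < s := hε.trans_le hεs
  have hdecay := dilate_decay_nonneg hs0 y x
  have hrate := dampingRate_nonneg hs0.le l a
  rw [frozenHeatKernelDeriv, norm_smul, norm_neg, Real.norm_of_nonneg hrate]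
  calc dampingRate l a s * ‖a • dilate (heatKernel E l) s y x +
        (s ^ (2 * l))⁻¹ • dilate (polyLaplacian l (heatKernel E l)) s y x‖
      ≤ 2 * l * (a * (A * dilate decay s y x) +
          (s ^ (2 * l))⁻¹ * (B * dilate decay s y x)) := by
        gcongr
        · exact dampingRate_le ha hs0.le hs l
        · refine norm_add_le_of_le ?_ ?_ <;>
            rw [norm_smul, Real.norm_of_nonneg (by positivity)] <;> gcongr
          · exact norm_dilate_le hK hs0 y x
          · exact norm_dilate_le hL hs0 y x
    _ = 2 * l * ((a * A + (s ^ (2 * l))⁻¹ * B) * dilate decay s y x) := by ring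
    _ ≤ 2 * l * ((a * A + (ε ^ (2 * l))⁻¹ * B) *
          ((ε ^ Module.finrank ℝ E)⁻¹ * decay (x - y))) := by
        gcongr
        exact dilate_decay_le hε hεs hs y x
    _ = _ := by ring

theorem integrable_mul_frozenHeatKernelDeriv [NeZero l] (hu : MemLp u 2) {a ε δ : ℝ} (ha : 0 ≤ a)
    (hε : 0 < ε) (hδ : δ ≤ 1) (y : E) :
    Integrable (Function.uncurry fun x s ↦ u x * frozenHeatKernelDeriv l a s y x)
      (volume.prod (volume.restrict (Set.Ioc ε δ))) := by
  obtain ⟨C, hC⟩ := exists_norm_frozenHeatKernelDeriv_le (E := E) (l := l) ha hε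
  have hdecay : MemLp (fun x ↦ decay (x - y)) 2 :=
    memLp_two_decay.comp_measurePreserving (measurePreserving_sub_right volume y)
  have hbound : Integrable (fun p : E × ℝ ↦ (‖u p.1‖ * decay (p.1 - y)) * C)
      (volume.prod (volume.restrict (Set.Ioc ε δ))) :=
    (hu.norm.integrable_mul hdecay).mul_prod (integrable_const C)
  have hs : ∀ᵐ p : E × ℝ ∂volume.prod (volume.restrict (Set.Ioc ε δ)), p.2 ∈ Set.Ioc ε δ :=
    Measure.quasiMeasurePreserving_snd.ae (ae_restrict_mem measurableSet_Ioc)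
  refine hbound.mono'
    (hu.1.comp_fst.mul (measurable_frozenHeatKernelDeriv a y).aestronglyMeasurable) ?_
  filter_upwards [hs] with ⟨x, s⟩ hs
  rw [Function.uncurry_apply_pair, norm_mul, mul_assoc, mul_comm (decay _)]
  gcongr
  exact hC s hs.1.le (hs.2.trans hδ) y x

theorem integral_mul_frozenHeatKernel [NeZero l] (u : E → ℂ) (a s : ℝ) (y : E) :
    ∫ x, u x * frozenHeatKernel l a s y x =
      exp (-(s ^ (2 * l) * a)) • ∫ x, u x * dilate (heatKernel E l) s y x := by
  simp only [frozenHeatKernel, mul_smul_comm, integral_smul]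

theorem integrable_mul_frozenHeatKernel [NeZero l] (hu : MemLp u 2) (a : ℝ) {s : ℝ} (hs : 0 < s)
    (y : E) : Integrable fun x ↦ u x * frozenHeatKernel l a s y x := by
  have h : Integrable fun x ↦ u x * dilate (heatKernel E l) s y x :=
    hu.integrable_mul (memLp_dilate _ hs y 2)
  simpa only [frozenHeatKernel, mul_smul_comm] using h.fun_smul (exp (-(s ^ (2 * l) * a)))

theorem integral_mul_frozenHeatKernel_sub [NeZero l] (hu : MemLp u 2) {a ε δ : ℝ} (ha : 0 ≤ a)
    (hε : 0 < ε) (hεδ : ε ≤ δ) (hδ : δ ≤ 1) (y : E) :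
    (∫ x, u x * frozenHeatKernel l a δ y x) - ∫ x, u x * frozenHeatKernel l a ε y x =
      ∫ s in Set.Ioc ε δ, ∫ x, u x * frozenHeatKernelDeriv l a s y x := by
  rw [← integral_integral_swap (integrable_mul_frozenHeatKernelDeriv hu ha hε hδ y),
    ← integral_sub (integrable_mul_frozenHeatKernel hu a (hε.trans_le hεδ) y)
      (integrable_mul_frozenHeatKernel hu a hε y)]
  simp only [integral_const_mul, integral_frozenHeatKernelDeriv a hε hεδ, mul_sub]

theorem IsWeakSolution.exists_enorm_integral_frozenHeatKernelDeriv_le [NeZero l]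
    (h : IsWeakSolution V l u c) (hV : IsSlowlyVarying V) (hu : MemLp u 2) :
    ∃ B : ℝ≥0, ∀ s, 0 < s → s ≤ 1 → ∀ y,
      ‖∫ x, u x * frozenHeatKernelDeriv l (V y) s y x‖ₑ ≤
        B * ∫⁻ x, ENNReal.ofReal (dilate decay s y x) * ‖u x‖ₑ := by
  obtain ⟨B, hB, herror⟩ := hV.exists_norm_error_le l c
  lift B to ℝ≥0 using hB
  refine ⟨B, fun s hs hs1 y ↦ ?_⟩
  rw [h.integral_frozenHeatKernelDeriv hV.hasTemperateGrowth hu (V y) hs,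
    ← lintegral_const_mul' _ _ ENNReal.coe_ne_top]
  refine (enorm_integral_le_lintegral_enorm _).trans (lintegral_mono fun x ↦ ?_)
  rw [enorm_mul, mul_comm, ← mul_assoc]
  gcongr
  rw [← ofReal_norm, ← ENNReal.ofReal_coe_nnreal, ← ENNReal.ofReal_mul B.coe_nonneg]
  exact ENNReal.ofReal_le_ofReal (herror s hs hs1 x y)

theorem enorm_integral_mul_frozenHeatKernel [NeZero l] (u : E → ℂ) (a s : ℝ) (y : E) :
    ‖∫ x, u x * frozenHeatKernel l a s y x‖ₑ =
      ENNReal.ofReal (exp (-(s ^ (2 * l) * a))) *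
        ‖∫ x, u x * dilate (heatKernel E l) s y x‖ₑ := by
  rw [integral_mul_frozenHeatKernel, enorm_smul, Real.enorm_of_nonneg (exp_nonneg _)]

theorem enorm_integral_mul_frozenHeatKernel_le [NeZero l] (hu : MemLp u 2) {a s : ℝ} (ha : 0 ≤ a)
    (hs : 0 < s) (y : E) :
    ‖∫ x, u x * frozenHeatKernel l a s y x‖ₑ ≤
      eLpNorm u 2 * eLpNorm (dilate (heatKernel E l) s 0) 2 := by
  have hexp : exp (-(s ^ (2 * l) * a)) ≤ 1 :=
    exp_le_one_iff.2 (neg_nonpos.2 (by positivity))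
  rw [enorm_integral_mul_frozenHeatKernel, ← eLpNorm_dilate_eq (heatKernel E l) s y]
  exact (mul_le_of_le_one_left' (ENNReal.ofReal_le_one.2 hexp)).trans
    (enorm_integral_mul_le hu.1 (memLp_dilate _ hs y 2).1)

theorem IsWeakSolution.exists_enorm_integral_dilate_le [NeZero l]
    (h : IsWeakSolution V l u c) (hV : IsSlowlyVarying V) (hu : MemLp u 2) :
    ∃ B : ℝ≥0, ∀ δ, 0 < δ → δ ≤ 1 → ∃ C : ℝ≥0∞, C ≠ ∞ ∧ ∀ ε, 0 < ε → ε ≤ δ → ∀ y,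
      ENNReal.ofReal (exp (-(ε ^ (2 * l) * V y))) *
          ‖∫ x, u x * dilate (heatKernel E l) ε y x‖ₑ ≤
        C + ∫⁻ s in Set.Ioc 0 δ, B * ∫⁻ x, ENNReal.ofReal (dilate decay s y x) * ‖u x‖ₑ := by
  obtain ⟨B, hB⟩ := h.exists_enorm_integral_frozenHeatKernelDeriv_le hV hu
  refine ⟨B, fun δ hδ hδ1 ↦ ?_⟩
  have hC : eLpNorm u 2 * eLpNorm (dilate (heatKernel E l) δ 0) 2 ≠ ∞ :=
    ENNReal.mul_ne_top hu.eLpNorm_ne_top (memLp_dilate _ hδ 0 2).eLpNorm_ne_top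
  refine ⟨_, hC, fun ε hε hεδ y ↦ ?_⟩
  have hduhamel : ∫ x, u x * frozenHeatKernel l (V y) ε y x =
      (∫ x, u x * frozenHeatKernel l (V y) δ y x) -
        ∫ s in Set.Ioc ε δ, ∫ x, u x * frozenHeatKernelDeriv l (V y) s y x := by
    rw [← integral_mul_frozenHeatKernel_sub hu (hV.nonneg y) hε hεδ hδ1, sub_sub_cancel]
  have herror : ‖∫ s in Set.Ioc ε δ, ∫ x, u x * frozenHeatKernelDeriv l (V y) s y x‖ₑ ≤
      ∫⁻ s in Set.Ioc 0 δ, B * ∫⁻ x, ENNReal.ofReal (dilate decay s y x) * ‖u x‖ₑ := by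
    refine (enorm_integral_le_lintegral_enorm _).trans ?_
    refine (setLIntegral_mono' measurableSet_Ioc fun s hs ↦
      hB s (hε.trans hs.1) (hs.2.trans hδ1) y).trans ?_
    exact lintegral_mono_set (Set.Ioc_subset_Ioc_left hε.le)
  rw [← enorm_integral_mul_frozenHeatKernel, hduhamel]
  exact enorm_sub_le.trans
    (add_le_add (enorm_integral_mul_frozenHeatKernel_le hu (hV.nonneg y) hδ y) herror)

end Duhamel

section ApproximateIdentity

open Filter Topology

theorem eLpNorm_two_sq {α F : Type*} [MeasurableSpace α] [NormedAddCommGroup F] {μ : Measure α}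
    (f : α → F) : eLpNorm f 2 μ ^ 2 = ∫⁻ x, ‖f x‖ₑ ^ 2 ∂μ := by
  simpa using eLpNorm_nnreal_pow_eq_lintegral (f := f) (μ := μ) (two_ne_zero : (2 : ℝ≥0) ≠ 0)

theorem sq_lintegral_mul_le {α : Type*} [MeasurableSpace α] {μ : Measure α} {a b : α → ℝ≥0∞}
    (ha : AEMeasurable a μ) (hb : AEMeasurable b μ) :
    (∫⁻ x, a x * b x ∂μ) ^ 2 ≤ (∫⁻ x, a x ∂μ) * ∫⁻ x, a x * b x ^ 2 ∂μ := by
  have hsq (r : ℝ≥0∞) : (r ^ (1 / 2 : ℝ)) ^ 2 = r := by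
    rw [← ENNReal.rpow_mul_natCast]; norm_num
  have hsplit (r t : ℝ≥0∞) : r ^ (1 / 2 : ℝ) * (r * t ^ 2) ^ (1 / 2 : ℝ) = r * t := by
    rw [ENNReal.mul_rpow_of_nonneg _ _ (by norm_num), ← mul_assoc, ← sq, hsq,
      ← ENNReal.rpow_natCast_mul]
    norm_num
  have h := ENNReal.lintegral_mul_norm_pow_le ha (ha.mul (hb.pow_const 2))
    (p := 1 / 2) (q := 1 / 2) (by norm_num) (by norm_num) (by norm_num)
  simp only [Pi.mul_apply, hsplit] at h
  simpa only [mul_pow, hsq] using pow_le_pow_left₀ zero_le h 2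

variable {E : Type*} [NormedAddCommGroup E] [InnerProductSpace ℝ E] [FiniteDimensional ℝ E]
  [MeasurableSpace E] [BorelSpace E] {u : E → ℂ}

theorem tendsto_eLpNorm_translate_sub (hu : MemLp u 2) :
    Tendsto (fun h ↦ eLpNorm (fun y ↦ u (h + y) - u y) 2) (𝓝 0) (𝓝 0) := by
  have : Fact ((2 : ℝ≥0∞) ≠ ∞) := ⟨by simp⟩
  have hmem (h : E) : MemLp (fun y ↦ u (h + y)) 2 :=
    hu.comp_measurePreserving (measurePreserving_add_left volume h)
  have hcont : Continuous fun h : E ↦ DomAddAct.mk h +ᵥ hu.toLp u :=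
    DomAddAct.mkHomeomorph.continuous.vadd continuous_const
  have hlim := hcont.tendsto 0
  rw [DomAddAct.mk_zero, zero_vadd] at hlim
  exact (Lp.tendsto_Lp_iff_tendsto_eLpNorm'' (fun h y ↦ u (h + y)) hmem u hu).1 hlim

theorem eLpNorm_translate_sub_le (hu : MemLp u 2) (h : E) :
    eLpNorm (fun y ↦ u (h + y) - u y) 2 ≤ 2 * eLpNorm u 2 := by
  have hmp := measurePreserving_add_left (volume : Measure E) h
  have h := eLpNorm_sub_le (hu.1.comp_measurePreserving hmp) hu.1 one_le_two
  rwa [eLpNorm_comp_measurePreserving hu.1 hmp, ← two_mul] at h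

theorem enorm_integral_dilate_sub_le (hu : MemLp u 2) {g : 𝓢(E, ℂ)} (hg : ∫ w, g w = 1) {s : ℝ}
    (hs : 0 < s) (y : E) :
    ‖(∫ x, u x * dilate g s y x) - u y‖ₑ ≤ ∫⁻ w, ‖g w‖ₑ * ‖u (s • w + y) - u y‖ₑ := by
  have hint : Integrable fun w ↦ u (y + s • w) * g w := by
    have h : Integrable fun x ↦ u x * dilate g s y x := hu.integrable_mul (memLp_dilate g hs y 2)
    have h' := ((h.comp_add_left y).comp_smul hs.ne').const_mul ((s ^ Module.finrank ℝ E : ℝ) : ℂ)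
    refine h'.congr (ae_of_all _ fun w ↦ ?_)
    have hs' : (s : ℂ) ≠ 0 := by exact_mod_cast hs.ne'
    simp only [dilate, add_sub_cancel_left, inv_smul_smul₀ hs.ne', Complex.real_smul]
    push_cast
    field_simp
  have hsub : (∫ x, u x * dilate g s y x) - u y = ∫ w, g w * (u (s • w + y) - u y) := by
    have hconst : u y = ∫ w, u y * g w := by rw [integral_const_mul, hg, mul_one]
    rw [integral_mul_dilate u g hs, hconst, ← integral_sub hint (g.integrable.const_mul _),
      ← hconst]
    exact integral_congr_ae (ae_of_all _ fun w ↦ by simp only [add_comm y]; ring)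
  rw [hsub]
  exact (enorm_integral_le_lintegral_enorm _).trans_eq (by simp only [enorm_mul])

theorem eLpNorm_integral_dilate_sub_sq_le (hu : MemLp u 2) (hum : Measurable u) {g : 𝓢(E, ℂ)}
    (hg : ∫ w, g w = 1) {s : ℝ} (hs : 0 < s) :
    eLpNorm (fun y ↦ (∫ x, u x * dilate g s y x) - u y) 2 ^ 2 ≤
      (∫⁻ w, ‖g w‖ₑ) * ∫⁻ w, ‖g w‖ₑ * eLpNorm (fun y ↦ u (s • w + y) - u y) 2 ^ 2 := by
  have hgm : Measurable g := g.continuous.measurable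
  have hfin : ∫⁻ w, ‖g w‖ₑ ≠ ∞ := g.integrable.2.ne
  have hCS (y : E) : ‖(∫ x, u x * dilate g s y x) - u y‖ₑ ^ 2 ≤
      (∫⁻ w, ‖g w‖ₑ) * ∫⁻ w, ‖g w‖ₑ * ‖u (s • w + y) - u y‖ₑ ^ 2 := by
    refine (pow_le_pow_left₀ zero_le (enorm_integral_dilate_sub_le hu hg hs y) 2).trans ?_
    exact sq_lintegral_mul_le (by fun_prop) (by fun_prop)
  simp only [eLpNorm_two_sq]
  refine (lintegral_mono hCS).trans_eq ?_
  rw [lintegral_const_mul' _ _ hfin,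
    lintegral_lintegral_swap (Measurable.aemeasurable (by fun_prop))]
  simp only [lintegral_const_mul' _ _ enorm_ne_top]

theorem tendsto_eLpNorm_integral_dilate_sub (hu : MemLp u 2) (hum : Measurable u) {g : 𝓢(E, ℂ)}
    (hg : ∫ w, g w = 1) :
    Tendsto (fun s ↦ eLpNorm (fun y ↦ (∫ x, u x * dilate g s y x) - u y) 2) (𝓝[>] 0) (𝓝 0) := by
  have hgm : Measurable g := g.continuous.measurable
  have hfin : ∫⁻ w, ‖g w‖ₑ ≠ ∞ := g.integrable.2.ne
  have hlim : Tendsto (fun s : ℝ ↦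
      ∫⁻ w, ‖g w‖ₑ * eLpNorm (fun y ↦ u (s • w + y) - u y) 2 ^ 2) (𝓝[>] 0) (𝓝 0) := by
    rw [← lintegral_zero (μ := (volume : Measure E))]
    refine tendsto_lintegral_filter_of_dominated_convergence
      (fun w ↦ ‖g w‖ₑ * (2 * eLpNorm u 2) ^ 2) (Eventually.of_forall fun s ↦ ?_)
      (Eventually.of_forall fun s ↦ ae_of_all _ fun w ↦ ?_) ?_ (ae_of_all _ fun w ↦ ?_)
    · simp only [eLpNorm_two_sq]
      exact hgm.enorm.mul (Measurable.lintegral_prod_right' (f := fun p : E × E ↦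
        ‖u (s • p.1 + p.2) - u p.2‖ₑ ^ 2) (by fun_prop))
    · gcongr
      exact eLpNorm_translate_sub_le hu _
    · rw [lintegral_mul_const _ hgm.enorm]
      have := hu.2.ne
      finiteness
    · have hsw : Tendsto (fun s : ℝ ↦ s • w) (𝓝[>] 0) (𝓝 0) :=
        (Continuous.tendsto' (by fun_prop) 0 0 (zero_smul ℝ w)).mono_left nhdsWithin_le_nhds
      have h := ENNReal.Tendsto.pow (n := 2) ((tendsto_eLpNorm_translate_sub hu).comp hsw)
      simpa using ENNReal.Tendsto.const_mul h (Or.inr (enorm_ne_top (x := g w)))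
  have hsq : Tendsto (fun s ↦ eLpNorm (fun y ↦ (∫ x, u x * dilate g s y x) - u y) 2 ^ 2)
      (𝓝[>] 0) (𝓝 0) := by
    refine tendsto_of_tendsto_of_tendsto_of_le_of_le' tendsto_const_nhds
      (by simpa using ENNReal.Tendsto.const_mul hlim (Or.inr hfin))
      (Eventually.of_forall fun _ ↦ zero_le) ?_
    filter_upwards [self_mem_nhdsWithin] with s hs
    exact eLpNorm_integral_dilate_sub_sq_le hu hum hg hs
  have hsqrt := ((ENNReal.continuous_rpow_const (y := (1 / 2 : ℝ))).tendsto 0).comp hsq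
  have hrpow (r : ℝ≥0∞) : (r ^ 2) ^ (1 / 2 : ℝ) = r := by
    rw [← ENNReal.rpow_natCast_mul]; norm_num
  simpa only [Function.comp_def, hrpow, ENNReal.zero_rpow_of_pos one_half_pos] using hsqrt

theorem exists_seq_tendsto_integral_dilate (hu : MemLp u 2) (hum : Measurable u) {g : 𝓢(E, ℂ)}
    (hg : ∫ w, g w = 1) : ∃ ε : ℕ → ℝ, Tendsto ε atTop (𝓝[>] 0) ∧
      ∀ᵐ y, Tendsto (fun m ↦ ∫ x, u x * dilate g (ε m) y x) atTop (𝓝 (u y)) := by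
  refine (tendstoInMeasure_of_tendsto_eLpNorm two_ne_zero (fun s ↦ ?_) hu.1
    (tendsto_eLpNorm_integral_dilate_sub hu hum hg)).exists_seq_tendsto_ae'
  have hdilate : Measurable fun p : E × E ↦ dilate g s p.1 p.2 :=
    measurable_dilate g.continuous.measurable measurable_const measurable_fst measurable_snd
  exact (StronglyMeasurable.integral_prod_right' (f := fun p : E × E ↦
    u p.2 * dilate g s p.1 p.2) (by fun_prop)).aestronglyMeasurable

end ApproximateIdentity

section SchurTest

variable {α : Type*} [MeasurableSpace α] {μ : Measure α} [SFinite μ] {k : α → α → ℝ≥0∞}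
  {f c d : α → ℝ≥0∞} {m : ℝ≥0∞}

theorem lintegral_sq_lintegral_mul_le (hk : Measurable (Function.uncurry k)) (hf : Measurable f)
    (hleft : ∀ y, ∫⁻ x, k y x ∂μ ≤ m) (hright : ∀ x, ∫⁻ y, k y x ∂μ ≤ m) :
    ∫⁻ y, (∫⁻ x, k y x * f x ∂μ) ^ 2 ∂μ ≤ m ^ 2 * ∫⁻ x, f x ^ 2 ∂μ := by
  have hky (y : α) : Measurable (k y) := hk.of_uncurry_left
  have hkx (x : α) : Measurable fun y ↦ k y x := hk.of_uncurry_right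
  have hkf : Measurable (Function.uncurry fun y x ↦ k y x * f x ^ 2) :=
    hk.mul ((hf.pow_const 2).comp measurable_snd)
  have hmarginal : Measurable fun y ↦ ∫⁻ x, k y x * f x ^ 2 ∂μ := hkf.lintegral_prod_right'
  calc ∫⁻ y, (∫⁻ x, k y x * f x ∂μ) ^ 2 ∂μ
      ≤ ∫⁻ y, m * ∫⁻ x, k y x * f x ^ 2 ∂μ ∂μ := lintegral_mono fun y ↦
        (sq_lintegral_mul_le (hky y).aemeasurable hf.aemeasurable).trans (by gcongr; exact hleft y)
    _ = m * ∫⁻ x, (∫⁻ y, k y x ∂μ) * f x ^ 2 ∂μ := by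
        rw [lintegral_const_mul _ hmarginal, lintegral_lintegral_swap hkf.aemeasurable]
        simp only [lintegral_mul_const _ (hkx _)]
    _ ≤ m * ∫⁻ x, m * f x ^ 2 ∂μ := by gcongr with x; exact hright x
    _ = m ^ 2 * ∫⁻ x, f x ^ 2 ∂μ := by
        rw [lintegral_const_mul _ (hf.pow_const 2), sq, mul_assoc]

theorem ae_le_of_le_add_lintegral_mul (hk : Measurable (Function.uncurry k)) (hf : Measurable f)
    (hd : Measurable d) (hm : m < 1) (hleft : ∀ y, ∫⁻ x, k y x ∂μ ≤ m)
    (hright : ∀ x, ∫⁻ y, k y x ∂μ ≤ m) (hf2 : ∫⁻ x, f x ^ 2 ∂μ ≠ ∞)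
    (hsub : ∀ᵐ y ∂μ, f y ≤ c y + ∫⁻ x, k y x * f x ∂μ)
    (hsuper : ∀ᵐ y ∂μ, c y + ∫⁻ x, k y x * d x ∂μ ≤ d y) : f ≤ᵐ[μ] d := by
  have hkd (y : α) : Measurable fun x ↦ k y x * d x := hk.of_uncurry_left.mul hd
  have hfd : Measurable fun y ↦ f y - d y := hf.sub hd
  have hexcess : ∀ᵐ y ∂μ, f y - d y ≤ ∫⁻ x, k y x * (f x - d x) ∂μ := by
    filter_upwards [hsub, hsuper] with y hfy hdy
    rw [tsub_le_iff_left]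
    calc f y ≤ c y + ∫⁻ x, k y x * f x ∂μ := hfy
      _ ≤ c y + ∫⁻ x, (k y x * d x + k y x * (f x - d x)) ∂μ := by
          gcongr with x
          rw [← mul_add]
          gcongr
          exact le_add_tsub
      _ = (c y + ∫⁻ x, k y x * d x ∂μ) + ∫⁻ x, k y x * (f x - d x) ∂μ := by
          rw [lintegral_add_left (hkd y), add_assoc]
      _ ≤ d y + ∫⁻ x, k y x * (f x - d x) ∂μ := by gcongr
  have hcontract : ∫⁻ y, (f y - d y) ^ 2 ∂μ ≤ m ^ 2 * ∫⁻ y, (f y - d y) ^ 2 ∂μ :=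
    (lintegral_mono_ae (hexcess.mono fun y hy ↦ by gcongr)).trans
      (lintegral_sq_lintegral_mul_le hk hfd hleft hright)
  have hfin : ∫⁻ y, (f y - d y) ^ 2 ∂μ ≠ ∞ :=
    ne_top_of_le_ne_top hf2 (lintegral_mono fun y ↦ by gcongr; exact tsub_le_self)
  have hzero : ∫⁻ y, (f y - d y) ^ 2 ∂μ = 0 := by
    by_contra hne
    have hlt := ENNReal.mul_lt_mul_left hne hfin (pow_lt_one₀ zero_le hm two_ne_zero)
    rw [one_mul] at hlt
    exact hcontract.not_gt hlt
  filter_upwards [(lintegral_eq_zero_iff (hfd.pow_const 2)).1 hzero] with y hy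
  exact tsub_eq_zero_iff_le.1 (pow_eq_zero_iff two_ne_zero |>.1 hy)

end SchurTest

section Boundedness

open Filter Topology

variable {E : Type*} [NormedAddCommGroup E] [InnerProductSpace ℝ E]

/-- The kernel `∫₀^δ B s⁻ⁿ decay ((x - y) / s) ds` of the operator that bounds the contribution of
all scales below `δ` to a weak solution. -/
noncomputable def errorKernel (B : ℝ≥0∞) (δ : ℝ) (y x : E) : ℝ≥0∞ :=
  ∫⁻ s in Set.Ioc 0 δ, B * ENNReal.ofReal (dilate decay s y x)

theorem errorKernel_comm (B : ℝ≥0∞) (δ : ℝ) (y x : E) :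
    errorKernel B δ y x = errorKernel B δ x y := by
  simp only [errorKernel, dilate_decay_comm _ y x]

variable [FiniteDimensional ℝ E] [MeasurableSpace E] [BorelSpace E] {V : E → ℝ} {l : ℕ} {u : E → ℂ}
  {c : ℂ}

theorem measurable_ofReal_dilate_decay {X : Type*} [MeasurableSpace X] {s : X → ℝ}
    (hs : Measurable s) {y x : X → E} (hy : Measurable y) (hx : Measurable x) :
    Measurable fun p ↦ ENNReal.ofReal (dilate decay (s p) (y p) (x p)) :=
  (measurable_dilate continuous_decay.measurable hs hy hx).ennreal_ofReal

theorem measurable_errorKernel (B : ℝ≥0∞) (δ : ℝ) :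
    Measurable (Function.uncurry (errorKernel (E := E) B δ)) :=
  Measurable.lintegral_prod_right' (f := fun p : (E × E) × ℝ ↦
    B * ENNReal.ofReal (dilate decay p.2 p.1.1 p.1.2))
    ((measurable_ofReal_dilate_decay measurable_snd measurable_fst.fst
      measurable_fst.snd).const_mul B)

theorem lintegral_errorKernel_mul (B : ℝ≥0∞) (δ : ℝ) (y : E) {f : E → ℝ≥0∞} (hf : Measurable f) :
    ∫⁻ x, errorKernel B δ y x * f x =
      ∫⁻ s in Set.Ioc 0 δ, B * ∫⁻ x, ENNReal.ofReal (dilate decay s y x) * f x := by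
  have hkernel : Measurable fun p : ℝ × E ↦ ENNReal.ofReal (dilate decay p.1 y p.2) :=
    measurable_ofReal_dilate_decay measurable_fst measurable_const measurable_snd
  have hs (s : ℝ) : Measurable fun x ↦ ENNReal.ofReal (dilate decay s y x) * f x :=
    (hkernel.comp measurable_prodMk_left).mul hf
  have hx (x : E) : Measurable fun s ↦ B * ENNReal.ofReal (dilate decay s y x) :=
    (hkernel.comp measurable_prodMk_right).const_mul B
  have hprod : Measurable (Function.uncurry fun (x : E) (s : ℝ) ↦
      B * (ENNReal.ofReal (dilate decay s y x) * f x)) :=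
    ((hkernel.comp measurable_swap).mul (hf.comp measurable_fst)).const_mul B
  simp only [errorKernel, ← lintegral_const_mul _ (hs _), ← lintegral_mul_const _ (hx _),
    mul_assoc]
  exact lintegral_lintegral_swap hprod.aemeasurable

theorem lintegral_errorKernel (B : ℝ≥0∞) (δ : ℝ) (y : E) :
    ∫⁻ x, errorKernel B δ y x =
      B * (∫⁻ w, ENNReal.ofReal (decay w : ℝ) ∂(volume : Measure E)) * ENNReal.ofReal δ := by
  have h := lintegral_errorKernel_mul B δ y (measurable_const (a := 1))
  simp only [mul_one] at h
  rw [h, setLIntegral_congr_fun measurableSet_Ioc fun s hs ↦ by rw [lintegral_dilate_decay hs.1],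
    setLIntegral_const, Real.volume_Ioc, sub_zero]

theorem IsWeakSolution.exists_ae_enorm_le [NeZero l] (h : IsWeakSolution V l u c)
    (hV : IsSlowlyVarying V) (hu : MemLp u 2) (hum : Measurable u) :
    ∃ B : ℝ≥0, ∀ δ, 0 < δ → δ ≤ 1 → ∃ C : ℝ≥0∞, C ≠ ∞ ∧
      ∀ᵐ y, ‖u y‖ₑ ≤ C + ∫⁻ x, errorKernel B δ y x * ‖u x‖ₑ := by
  obtain ⟨B, hB⟩ := h.exists_enorm_integral_dilate_le hV hu
  refine ⟨B, fun δ hδ hδ1 ↦ ?_⟩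
  obtain ⟨C, hC, hbound⟩ := hB δ hδ hδ1
  obtain ⟨ε, hε, hlim⟩ := exists_seq_tendsto_integral_dilate hu hum (integral_heatKernel (l := l))
  refine ⟨C, hC, ?_⟩
  filter_upwards [hlim] with y hy
  have hfactor : Tendsto (fun m ↦ ENNReal.ofReal (Real.exp (-(ε m ^ (2 * l) * V y)))) atTop
      (𝓝 1) := by
    have hcont : Continuous fun t : ℝ ↦ ENNReal.ofReal (Real.exp (-(t ^ (2 * l) * V y))) :=
      ENNReal.continuous_ofReal.comp (by fun_prop)
    exact (hcont.tendsto' 0 1 (by simp [NeZero.ne l])).comp (hε.mono_right nhdsWithin_le_nhds)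
  have hprod := ENNReal.Tendsto.mul hfactor (Or.inl one_ne_zero) hy.enorm (Or.inr (by simp))
  rw [one_mul] at hprod
  refine le_of_tendsto hprod ?_
  filter_upwards [hε (Ioc_mem_nhdsGT hδ)] with m hm
  rw [lintegral_errorKernel_mul _ _ _ hum.enorm]
  exact hbound (ε m) hm.1 hm.2 y

theorem exists_lintegral_errorKernel_le (B : ℝ≥0) :
    ∃ δ, 0 < δ ∧ δ ≤ 1 ∧ ∀ y : E, ∫⁻ x, errorKernel B δ y x ≤ 2⁻¹ := by
  have hmass : ∫⁻ w, ENNReal.ofReal (decay w) ∂(volume : Measure E) ≠ ∞ :=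
    integrable_decay.lintegral_lt_top.ne
  have hlim : Tendsto (fun δ ↦ (B : ℝ≥0∞) *
      (∫⁻ w, ENNReal.ofReal (decay w) ∂(volume : Measure E)) * ENNReal.ofReal δ)
      (𝓝[>] 0) (𝓝 0) := by
    have hδ : Tendsto ENNReal.ofReal (𝓝[>] 0) (𝓝 0) :=
      (ENNReal.continuous_ofReal.tendsto' 0 0 ENNReal.ofReal_zero).mono_left nhdsWithin_le_nhds
    simpa using ENNReal.Tendsto.const_mul hδ (Or.inr (ENNReal.mul_ne_top ENNReal.coe_ne_top hmass))
  have hsmall : (0 : ℝ≥0∞) < 2⁻¹ := by simp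
  have hunit : ∀ᶠ δ in 𝓝[>] (0 : ℝ), δ ∈ Set.Ioc 0 1 := Ioc_mem_nhdsGT zero_lt_one
  obtain ⟨δ, hδ, hle⟩ := (hunit.and (hlim.eventually_le_const hsmall)).exists
  exact ⟨δ, hδ.1, hδ.2, fun y ↦ (lintegral_errorKernel _ _ y).trans_le hle⟩

theorem IsWeakSolution.eLpNorm_top_lt_top [NeZero l] (h : IsWeakSolution V l u c)
    (hV : IsSlowlyVarying V) (hu : MemLp u 2) (hum : Measurable u) : eLpNorm u ∞ < ∞ := by
  obtain ⟨B, hB⟩ := h.exists_ae_enorm_le hV hu hum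
  obtain ⟨δ, hδ, hδ1, hleft⟩ := exists_lintegral_errorKernel_le (E := E) B
  obtain ⟨C, hC, hbound⟩ := hB δ hδ hδ1
  have hright (x : E) : ∫⁻ y, errorKernel B δ y x ≤ 2⁻¹ := by
    simpa only [errorKernel_comm _ _ _ x] using hleft x
  have hfin : ∫⁻ x, ‖u x‖ₑ ^ 2 ≠ ∞ := by
    rw [← eLpNorm_two_sq]
    exact ENNReal.pow_ne_top hu.eLpNorm_ne_top
  have hsuper (y : E) : C + ∫⁻ x, errorKernel B δ y x * (2 * C) ≤ 2 * C := by
    rw [lintegral_mul_const _ (measurable_errorKernel _ _).of_uncurry_left]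
    calc _ ≤ C + 2⁻¹ * (2 * C) := by gcongr; exact hleft y
      _ = 2 * C := by
        rw [← mul_assoc, ENNReal.inv_mul_cancel two_ne_zero ENNReal.ofNat_ne_top, one_mul, two_mul]
  have hle : ∀ᵐ y, ‖u y‖ₑ ≤ 2 * C :=
    ae_le_of_le_add_lintegral_mul (measurable_errorKernel _ _) hum.enorm measurable_const
      ENNReal.one_half_lt_one hleft hright hfin hbound (ae_of_all _ hsuper)
  rw [eLpNorm_exponent_top]
  exact (essSup_le_of_ae_le _ hle).trans_lt (ENNReal.mul_lt_top (by simp) hC.lt_top)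

end Boundedness

section HausdorffYoung

open Complex.HadamardThreeLines

theorem norm_le_rpow_of_mem_strip {Φ : ℂ → ℂ} (hΦ : Differentiable ℂ Φ)
    (hbdd : BddAbove ((norm ∘ Φ) '' verticalClosedStrip 0 1)) {A : ℝ} (hA : 0 ≤ A)
    (h0 : ∀ z, z.re = 0 → ‖Φ z‖ ≤ A) (h1 : ∀ z, z.re = 1 → ‖Φ z‖ ≤ √A)
    {θ : ℝ} (hθ0 : 0 ≤ θ) (hθ1 : θ ≤ 1) : ‖Φ θ‖ ≤ A ^ (1 - θ / 2) := by
  have key := norm_le_interp_of_mem_verticalClosedStrip₀₁' Φ (z := (θ : ℂ))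
    ⟨by simpa using hθ0, by simpa using hθ1⟩ hΦ.diffContOnCl hbdd h0 h1
  rw [Complex.ofReal_re, Real.sqrt_eq_rpow, ← Real.rpow_mul hA,
    ← Real.rpow_add_of_nonneg hA (by linarith) (by positivity)] at key
  exact key.trans_eq (by ring_nf)

/-- The analytic family `a ↦ |a|^{r (1 - z / 2)} sgn a` of the Riesz–Thorin argument. On `re z = 0`
it has modulus `|a|^r`, on `re z = 1` modulus `|a|^{r / 2}`. -/
noncomputable def phasePow (r : ℝ) (z a : ℂ) : ℂ := (‖a‖ : ℂ) ^ (r * (1 - z / 2)) * (a / ‖a‖)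

theorem phasePow_zero (r : ℝ) (z : ℂ) : phasePow r z 0 = 0 := by simp [phasePow]

theorem norm_phasePow {r : ℝ} {z : ℂ} (h : 0 < r * (1 - z.re / 2)) (a : ℂ) :
    ‖phasePow r z a‖ = ‖a‖ ^ (r * (1 - z.re / 2)) := by
  rcases eq_or_ne a 0 with rfl | ha
  · rw [phasePow_zero, norm_zero, Real.zero_rpow h.ne']
  · have ha' : 0 < ‖a‖ := norm_pos_iff.2 ha
    rw [phasePow, norm_mul, Complex.norm_cpow_eq_rpow_re_of_pos ha', norm_div, Complex.norm_real,
      norm_norm, div_self ha'.ne', mul_one]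
    congr 1
    simp

theorem norm_phasePow_of_re_eq_zero {r : ℝ} (hr : 0 < r) {z : ℂ} (hz : z.re = 0) (a : ℂ) :
    ‖phasePow r z a‖ = ‖a‖ ^ r := by
  rw [norm_phasePow (by rw [hz]; linarith), hz, zero_div, sub_zero, mul_one]

theorem sq_norm_phasePow_of_re_eq_one {r : ℝ} (hr : 0 < r) {z : ℂ} (hz : z.re = 1) (a : ℂ) :
    ‖phasePow r z a‖ ^ 2 = ‖a‖ ^ r := by
  rw [norm_phasePow (by rw [hz]; linarith), hz, ← Real.rpow_mul_natCast (norm_nonneg _)]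
  congr 1
  push_cast
  ring

theorem phasePow_of_mul_eq_one {r t : ℝ} (h : r * (1 - t / 2) = 1) (a : ℂ) :
    phasePow r t a = a := by
  rcases eq_or_ne a 0 with rfl | ha
  · exact phasePow_zero r t
  · have hexp : (r : ℂ) * (1 - t / 2) = 1 := by exact_mod_cast h
    rw [phasePow, hexp, Complex.cpow_one, mul_div_cancel₀ _ (by simpa using ha)]

theorem differentiable_phasePow (r : ℝ) (a : ℂ) : Differentiable ℂ fun z ↦ phasePow r z a := by
  rcases eq_or_ne a 0 with rfl | ha
  · simp only [phasePow_zero]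
    exact differentiable_const 0
  · exact fun z ↦
      (DifferentiableAt.const_cpow (by fun_prop) (Or.inl (by simpa using ha))).mul_const _

theorem norm_phasePow_le {r : ℝ} (hr : 0 < r) {z : ℂ} (hz : z ∈ verticalClosedStrip 0 1) (a : ℂ) :
    ‖phasePow r z a‖ ≤ (1 + ‖a‖) ^ r := by
  obtain ⟨h0, h1⟩ : 0 ≤ z.re ∧ z.re ≤ 1 := hz
  have h : 0 < r * (1 - z.re / 2) := mul_pos hr (by linarith)
  rw [norm_phasePow h]
  calc ‖a‖ ^ (r * (1 - z.re / 2)) ≤ (1 + ‖a‖) ^ (r * (1 - z.re / 2)) :=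
        Real.rpow_le_rpow (norm_nonneg _) (by linarith) h.le
    _ ≤ (1 + ‖a‖) ^ r :=
        Real.rpow_le_rpow_of_exponent_le (by linarith [norm_nonneg a]) (by nlinarith)

variable {α ι : Type*} [MeasurableSpace α] {μ : Measure α}

/-- The Fourier coefficient `∫ f conj(g)` of `f` with respect to `g`. -/
noncomputable def coeff (μ : Measure α) (f g : α → ℂ) : ℂ := ∫ x, f x * conj (g x) ∂μ

theorem coeff_simpleFunc_map {f : SimpleFunc α ℂ} (hf : f.FinMeasSupp μ) {g : α → ℂ}
    (hg : MemLp g 2 μ) {φ : ℂ → ℂ} (hφ : φ 0 = 0) :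
    coeff μ (f.map φ) g = ∑ a ∈ f.range, φ a * ∫ x in f ⁻¹' {a}, conj (g x) ∂μ := by
  have hsum (x : α) : f.map φ x * conj (g x) =
      ∑ a ∈ f.range, φ a * (f ⁻¹' {a}).indicator (fun x ↦ conj (g x)) x := by
    rw [Finset.sum_eq_single_of_mem (f x) (f.mem_range_self x), Set.indicator_of_mem (by simp),
      SimpleFunc.map_apply]
    intro a _ ha
    rw [Set.indicator_of_notMem (by simpa using ha.symm), mul_zero]
  simp_rw [coeff, hsum]
  rw [integral_finsetSum]
  · simp_rw [integral_const_mul, integral_indicator (f.measurableSet_preimage _)]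
  · intro a _
    rcases eq_or_ne a 0 with rfl | ha
    · simp [hφ]
    · have : IsFiniteMeasure (μ.restrict (f ⁻¹' {a})) :=
        ⟨by simpa using hf.meas_preimage_singleton_ne_zero ha⟩
      exact ((integrable_indicator_iff (f.measurableSet_preimage _)).2
        ((hg.star.restrict _).integrable one_le_two)).const_mul _

theorem norm_coeff_le_lpNorm_mul {f g : α → ℂ} (hf : Integrable f μ) (hg : MemLp g ∞ μ) :
    ‖coeff μ f g‖ ≤ lpNorm g ∞ μ * ∫ x, ‖f x‖ ∂μ := by
  refine (norm_integral_le_integral_norm _).trans ?_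
  rw [← integral_const_mul]
  refine integral_mono_of_nonneg (ae_of_all _ fun x ↦ norm_nonneg _) (hf.norm.const_mul _) ?_
  filter_upwards [ae_le_lpNorm_exponent_top hg] with x hx
  rw [norm_mul, RCLike.norm_conj, mul_comm]
  gcongr

theorem sum_sq_norm_coeff_le {e : ι → Lp ℂ 2 μ} (he : Orthonormal ℂ e) (J : Finset ι) {g : α → ℂ}
    (hg : MemLp g 2 μ) : ∑ j ∈ J, ‖coeff μ g (e j)‖ ^ 2 ≤ ∫ x, ‖g x‖ ^ 2 ∂μ := by
  have hinner (j : ι) : inner ℂ (e j) (hg.toLp g) = coeff μ g (e j) := by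
    rw [L2.inner_def, coeff]
    refine integral_congr_ae ?_
    filter_upwards [hg.coeFn_toLp] with x hx
    rw [hx, RCLike.inner_apply]
  have hnorm : ‖hg.toLp g‖ ^ 2 = ∫ x, ‖g x‖ ^ 2 ∂μ := by
    rw [← inner_self_eq_norm_sq (𝕜 := ℂ), L2.inner_def, ← integral_re (L2.integrable_inner _ _)]
    refine integral_congr_ae ?_
    filter_upwards [hg.coeFn_toLp] with x hx
    rw [inner_self_eq_norm_sq, hx]
  simpa only [hinner, hnorm] using he.sum_inner_products_le (hg.toLp g)

/-- The analytic function to which the three lines theorem is applied in the bilinear form of the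
Hausdorff–Young inequality; `b` is the sequence dual to the weighted Fourier coefficients. -/
noncomputable def interpolant (r : ℝ) (e : ι → Lp ℂ 2 μ) (J : Finset ι) (b : ι → ℂ)
    (f : SimpleFunc α ℂ) (z : ℂ) : ℂ :=
  ∑ j ∈ J, (lpNorm (e j) ∞ μ : ℂ) * phasePow r z (b j) * coeff μ (f.map (phasePow r z)) (e j)

variable {e : ι → Lp ℂ 2 μ} {J : Finset ι} {b : ι → ℂ} {f : SimpleFunc α ℂ} {r : ℝ}

theorem interpolant_eq (hf : f.FinMeasSupp μ) (z : ℂ) :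
    interpolant r e J b f z = ∑ j ∈ J, (lpNorm (e j) ∞ μ : ℂ) * phasePow r z (b j) *
      ∑ a ∈ f.range, phasePow r z a * ∫ x in f ⁻¹' {a}, conj (e j x) ∂μ := by
  simp_rw [interpolant, coeff_simpleFunc_map hf (Lp.memLp (e _)) (phasePow_zero r z)]

theorem differentiable_interpolant (hf : f.FinMeasSupp μ) :
    Differentiable ℂ (interpolant r e J b f) := by
  rw [funext (interpolant_eq hf)]
  exact Differentiable.fun_sum fun j _ ↦ ((differentiable_phasePow r _).const_mul _).mul
    (Differentiable.fun_sum fun a _ ↦ (differentiable_phasePow r a).mul_const _)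

theorem bddAbove_norm_interpolant (hr : 0 < r) (hf : f.FinMeasSupp μ) :
    BddAbove ((norm ∘ interpolant r e J b f) '' verticalClosedStrip 0 1) := by
  refine ⟨∑ j ∈ J, lpNorm (e j) ∞ μ * (1 + ‖b j‖) ^ r *
    ∑ a ∈ f.range, (1 + ‖a‖) ^ r * ‖∫ x in f ⁻¹' {a}, conj (e j x) ∂μ‖, ?_⟩
  rintro _ ⟨z, hz, rfl⟩
  rw [Function.comp_apply, interpolant_eq hf]
  refine norm_sum_le_of_le _ fun j _ ↦ ?_
  rw [norm_mul, norm_mul, Complex.norm_real, Real.norm_of_nonneg lpNorm_nonneg]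
  have hsum : ‖∑ a ∈ f.range, phasePow r z a * ∫ x in f ⁻¹' {a}, conj (e j x) ∂μ‖ ≤
      ∑ a ∈ f.range, (1 + ‖a‖) ^ r * ‖∫ x in f ⁻¹' {a}, conj (e j x) ∂μ‖ :=
    norm_sum_le_of_le _ fun a _ ↦ by
      rw [norm_mul]
      gcongr
      exact norm_phasePow_le hr hz a
  have hM : 0 ≤ lpNorm (e j) ∞ μ := lpNorm_nonneg
  gcongr
  exact norm_phasePow_le hr hz _

theorem integral_rpow_norm_nonneg (f : α → ℂ) : 0 ≤ ∫ x, ‖f x‖ ^ r ∂μ :=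
  integral_nonneg fun _ ↦ by positivity

theorem norm_interpolant_le_of_re_eq_zero (hr : 0 < r) (htop : ∀ j, MemLp (e j) ∞ μ)
    (hf : f.FinMeasSupp μ) {z : ℂ} (hz : z.re = 0) :
    ‖interpolant r e J b f z‖ ≤
      (∑ j ∈ J, lpNorm (e j) ∞ μ ^ 2 * ‖b j‖ ^ r) * ∫ x, ‖f x‖ ^ r ∂μ := by
  rw [Finset.sum_mul]
  refine norm_sum_le_of_le _ fun j _ ↦ ?_
  have hint : Integrable (f.map (phasePow r z)) μ :=
    SimpleFunc.integrable_iff_finMeasSupp.2 (hf.map (phasePow_zero r z))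
  have hcoeff := norm_coeff_le_lpNorm_mul hint (htop j)
  simp only [SimpleFunc.map_apply, norm_phasePow_of_re_eq_zero hr hz] at hcoeff
  rw [norm_mul, norm_mul, Complex.norm_real, Real.norm_of_nonneg lpNorm_nonneg,
    norm_phasePow_of_re_eq_zero hr hz]
  have hM : 0 ≤ lpNorm (e j) ∞ μ := lpNorm_nonneg
  calc _ ≤ lpNorm (e j) ∞ μ * ‖b j‖ ^ r * (lpNorm (e j) ∞ μ * ∫ x, ‖f x‖ ^ r ∂μ) := by gcongr
    _ = _ := by ring

theorem norm_interpolant_le_of_re_eq_one (hr : 0 < r) (he : Orthonormal ℂ e)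
    (hf : f.FinMeasSupp μ) {z : ℂ} (hz : z.re = 1) :
    ‖interpolant r e J b f z‖ ≤
      √((∑ j ∈ J, lpNorm (e j) ∞ μ ^ 2 * ‖b j‖ ^ r) * ∫ x, ‖f x‖ ^ r ∂μ) := by
  have hbessel := sum_sq_norm_coeff_le he J
    ((SimpleFunc.memLp_iff_finMeasSupp two_ne_zero ENNReal.ofNat_ne_top).2
      (hf.map (phasePow_zero r z)))
  simp only [SimpleFunc.map_apply, sq_norm_phasePow_of_re_eq_one hr hz] at hbessel
  calc ‖interpolant r e J b f z‖
      ≤ ∑ j ∈ J, (lpNorm (e j) ∞ μ * ‖phasePow r z (b j)‖) *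
          ‖coeff μ (f.map (phasePow r z)) (e j)‖ := norm_sum_le_of_le _ fun j _ ↦ by
        rw [norm_mul, norm_mul, Complex.norm_real, Real.norm_of_nonneg lpNorm_nonneg]
    _ ≤ √(∑ j ∈ J, (lpNorm (e j) ∞ μ * ‖phasePow r z (b j)‖) ^ 2) *
          √(∑ j ∈ J, ‖coeff μ (f.map (phasePow r z)) (e j)‖ ^ 2) :=
        Real.sum_mul_le_sqrt_mul_sqrt _ _ _
    _ ≤ _ := by
        rw [Real.sqrt_mul' _ (integral_rpow_norm_nonneg f)]
        simp_rw [mul_pow, sq_norm_phasePow_of_re_eq_one hr hz]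
        gcongr

theorem norm_sum_mul_coeff_le (hr1 : 1 ≤ r) (hr2 : r ≤ 2) (he : Orthonormal ℂ e)
    (htop : ∀ j, MemLp (e j) ∞ μ) (hf : f.FinMeasSupp μ) :
    ‖∑ j ∈ J, (lpNorm (e j) ∞ μ : ℂ) * b j * coeff μ f (e j)‖ ≤
      ((∑ j ∈ J, lpNorm (e j) ∞ μ ^ 2 * ‖b j‖ ^ r) * ∫ x, ‖f x‖ ^ r ∂μ) ^ (1 / r) := by
  have hr : 0 < r := by linarith
  have hexp : r * (1 - (2 - 2 / r) / 2) = 1 := by field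
  have hA : 0 ≤ (∑ j ∈ J, lpNorm (e j) ∞ μ ^ 2 * ‖b j‖ ^ r) * ∫ x, ‖f x‖ ^ r ∂μ :=
    mul_nonneg (Finset.sum_nonneg fun j _ ↦ by positivity) (integral_rpow_norm_nonneg f)
  have key := norm_le_rpow_of_mem_strip (differentiable_interpolant hf)
    (bddAbove_norm_interpolant hr hf) hA
    (fun z ↦ norm_interpolant_le_of_re_eq_zero (J := J) (b := b) hr htop hf)
    (fun z ↦ norm_interpolant_le_of_re_eq_one hr he hf) (θ := 2 - 2 / r)
    (by rw [sub_nonneg, div_le_iff₀ hr]; linarith)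
    (by rw [sub_le_comm, le_div_iff₀ hr]; linarith)
  have hid : f.map (phasePow r (2 - 2 / r : ℝ)) = f :=
    SimpleFunc.ext fun x ↦ phasePow_of_mul_eq_one hexp _
  simp only [interpolant, hid, phasePow_of_mul_eq_one hexp] at key
  rwa [show 1 - (2 - 2 / r) / 2 = 1 / r by field] at key

theorem lpNorm_top_pos (htop : ∀ j, MemLp (e j) ∞ μ) (he : ∀ j, e j ≠ 0) (j : ι) :
    0 < lpNorm (e j) ∞ μ :=
  lpNorm_nonneg.lt_of_ne fun h ↦ he j <| (Lp.eq_zero_iff_ae_eq_zero).2 <|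
    (lpNorm_eq_zero (htop j) ENNReal.top_ne_zero).1 h.symm

theorem conj_div_norm_mul_self (c : ℂ) : conj c / ‖c‖ * c = ‖c‖ := by
  rcases eq_or_ne c 0 with rfl | hc
  · simp
  · rw [div_mul_eq_mul_div, Complex.conj_mul', sq, mul_div_cancel_right₀ _ (by simpa using hc)]

theorem norm_conj_div_norm_le_one (c : ℂ) : ‖conj c / ‖c‖‖ ≤ 1 := by
  rw [norm_div, RCLike.norm_conj, Complex.norm_real, norm_norm]
  exact div_self_le_one _

theorem exists_dual_sequence {r q : ℝ} (hrq : r.HolderConjugate q) (J : Finset ι) (c : ι → ℂ)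
    {M : ι → ℝ} (hM : ∀ j, 0 < M j) :
    ∃ b : ι → ℂ, ∑ j ∈ J, M j ^ 2 * ‖b j‖ ^ r ≤ 1 ∧
      ∑ j ∈ J, (M j : ℂ) * b j * c j =
        ((∑ j ∈ J, ‖c j‖ ^ q * M j ^ (2 - q)) ^ (1 / q) : ℝ) := by
  lift M to ι → ℝ≥0 using fun j ↦ (hM j).le
  have hq : q⁻¹ = 1 - r⁻¹ := hrq.one_sub_inv.symm
  have hr0 := hrq.ne_zero
  have hq0 := hrq.symm.ne_zero
  obtain ⟨g, hg, hgsum⟩ := (NNReal.isGreatest_Lp J (fun j ↦ ‖c j‖₊ * M j ^ (2 / q - 1))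
    hrq.symm).1
  refine ⟨fun j ↦ conj (c j) / ‖c j‖ * (g j * (M j : ℝ) ^ (2 / q - 2) : ℝ), ?_, ?_⟩
  · refine le_trans (Finset.sum_le_sum fun j _ ↦ ?_)
      (by exact_mod_cast hg : ∑ j ∈ J, (g j : ℝ) ^ r ≤ 1)
    have hexp : 2 + (2 / q - 2) * r = 0 := by
      rw [div_eq_mul_inv, hq]
      field
    calc (M j : ℝ) ^ 2 * ‖conj (c j) / ‖c j‖ * ((g j * (M j : ℝ) ^ (2 / q - 2) : ℝ) : ℂ)‖ ^ r
        ≤ (M j : ℝ) ^ 2 * (g j * (M j : ℝ) ^ (2 / q - 2)) ^ r := by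
          rw [norm_mul, Complex.norm_real, Real.norm_of_nonneg (by positivity)]
          exact mul_le_mul_of_nonneg_left (Real.rpow_le_rpow (by positivity)
            (mul_le_of_le_one_left (by positivity) (norm_conj_div_norm_le_one _)) hrq.nonneg)
            (by positivity)
      _ = (g j : ℝ) ^ r := by
          rw [Real.mul_rpow (by positivity) (by positivity), ← Real.rpow_mul (by positivity),
            ← Real.rpow_natCast, mul_left_comm, ← Real.rpow_add (hM j), Nat.cast_ofNat, hexp,
            Real.rpow_zero, mul_one]
  · have hpow (j : ι) : (‖c j‖₊ * M j ^ (2 / q - 1)) ^ q = ‖c j‖₊ ^ q * M j ^ (2 - q) := by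
      rw [NNReal.mul_rpow, ← NNReal.rpow_mul, sub_mul, div_mul_cancel₀ _ hq0, one_mul]
    have hterm (j : ι) : (M j : ℂ) * (conj (c j) / ‖c j‖ * (g j * (M j : ℝ) ^ (2 / q - 2) : ℝ)) *
        c j = (‖c j‖ * (M j : ℝ) ^ (2 / q - 1) * g j : ℝ) := by
      have hM1 : (M j : ℝ) ^ (2 / q - 1) = M j * (M j : ℝ) ^ (2 / q - 2) := by
        rw [mul_comm, ← Real.rpow_add_one (hM j).ne']
        ring_nf
      rw [hM1, mul_assoc, mul_right_comm, conj_div_norm_mul_self]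
      push_cast
      ring
    simp_rw [hpow] at hgsum
    simp_rw [hterm, ← Complex.ofReal_sum]
    exact congrArg _ (by simpa using congrArg NNReal.toReal hgsum)

theorem sum_rpow_norm_coeff_le_of_simpleFunc {q : ℝ} (hrq : r.HolderConjugate q) (hr2 : r ≤ 2)
    (he : Orthonormal ℂ e) (htop : ∀ j, MemLp (e j) ∞ μ) (hf : f.FinMeasSupp μ) :
    (∑ j ∈ J, ‖coeff μ f (e j)‖ ^ q * lpNorm (e j) ∞ μ ^ (2 - q)) ^ (1 / q) ≤
      (∫ x, ‖f x‖ ^ r ∂μ) ^ (1 / r) := by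
  obtain ⟨b, hb, hpair⟩ := exists_dual_sequence hrq J (fun j ↦ coeff μ f (e j))
    (lpNorm_top_pos htop he.ne_zero)
  have key := norm_sum_mul_coeff_le (J := J) (b := b) hrq.lt.le hr2 he htop hf
  rw [hpair, Complex.norm_real] at key
  have hQ : 0 ≤ ∫ x, ‖f x‖ ^ r ∂μ := integral_rpow_norm_nonneg f
  calc _ ≤ _ := (le_abs_self _).trans key
    _ ≤ (∫ x, ‖f x‖ ^ r ∂μ) ^ (1 / r) := by
      have := hrq.one_div_nonneg
      gcongr
      exact mul_le_of_le_one_left hQ hb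

end HausdorffYoung

section HausdorffYoungLp

variable {α ι : Type*} [MeasurableSpace α] {μ : Measure α} {p q : ℝ≥0∞}

theorem integrable_mul_conj [p.HolderConjugate q] {f g : α → ℂ} (hf : MemLp f p μ)
    (hg : MemLp g q μ) : Integrable (fun x ↦ f x * conj (g x)) μ :=
  hf.integrable_mul hg.star

theorem enorm_coeff_le [p.HolderConjugate q] {f g : α → ℂ} (hf : MemLp f p μ)
    (hg : MemLp g q μ) : ‖coeff μ f g‖ₑ ≤ eLpNorm f p μ * eLpNorm g q μ :=
  (enorm_integral_mul_le hf.1 hg.star.1).trans_eq <|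
    congrArg _ (eLpNorm_congr_norm_ae (ae_of_all _ fun x ↦ norm_star (g x)))

theorem continuous_coeff [p.HolderConjugate q] [Fact (1 ≤ p)] {g : α → ℂ} (hg : MemLp g q μ) :
    Continuous fun F : Lp ℂ p μ ↦ coeff μ F g := by
  have : Fact (1 ≤ q) := ⟨ENNReal.HolderConjugate.one_le q p⟩
  convert! (((ContinuousLinearMap.mul ℂ ℂ).lpPairing μ p q).flip (hg.star.toLp _)).continuous
    using 2 with F
  rw [ContinuousLinearMap.flip_apply, ContinuousLinearMap.lpPairing_eq_integral, coeff]
  refine integral_congr_ae ?_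
  filter_upwards [hg.star.coeFn_toLp] with x hx
  rw [hx]
  rfl

theorem memLp_of_two_le {g : α → ℂ} (h2 : MemLp g 2 μ) (htop : MemLp g ∞ μ) (hq : 2 ≤ q) :
    MemLp g q μ := by
  rcases eq_or_ne q ∞ with rfl | hqt
  · exact htop
  have hq2 : 2 ≤ q.toReal := by simpa using ENNReal.toReal_mono hqt hq
  refine (integrable_norm_rpow_iff h2.1 (two_pos.trans_le hq).ne' hqt).1 ?_
  refine ((h2.integrable_norm_pow two_ne_zero).const_mul (lpNorm g ∞ μ ^ (q.toReal - 2))).mono'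
    (h2.1.norm.aemeasurable.pow_const _).aestronglyMeasurable ?_
  filter_upwards [ae_le_lpNorm_exponent_top htop] with x hx
  calc ‖‖g x‖ ^ q.toReal‖ = ‖g x‖ ^ (q.toReal - 2) * ‖g x‖ ^ 2 := by
        rw [Real.norm_of_nonneg (by positivity), ← Real.rpow_two,
          ← Real.rpow_add_of_nonneg (norm_nonneg _) (by linarith) two_pos.le, sub_add_cancel]
    _ ≤ lpNorm g ∞ μ ^ (q.toReal - 2) * ‖g x‖ ^ 2 := by gcongr

variable {e : ι → Lp ℂ 2 μ}

theorem two_le_of_le_two [p.HolderConjugate q] (hp : p ≤ 2) : 2 ≤ q := by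
  rw [← ENNReal.inv_le_inv, ← ENNReal.HolderConjugate.one_sub_inv p q,
    ← ENNReal.one_sub_inv_two]
  exact tsub_le_tsub_left (ENNReal.inv_le_inv.2 hp) 1

theorem sum_rpow_norm_coeff_le [p.HolderConjugate q] (hp1 : 1 < p) (hp2 : p ≤ 2)
    (he : Orthonormal ℂ e) (htop : ∀ j, MemLp (e j) ∞ μ) (J : Finset ι) {f : α → ℂ}
    (hf : MemLp f p μ) :
    (∑ j ∈ J, ‖coeff μ f (e j)‖ ^ q.toReal * lpNorm (e j) ∞ μ ^ (2 - q.toReal)) ^ (1 / q.toReal) ≤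
      (eLpNorm f p μ).toReal := by
  have hp0 : p ≠ 0 := (zero_lt_one.trans hp1).ne'
  have hpt : p ≠ ∞ := ne_top_of_le_ne_top ENNReal.ofNat_ne_top hp2
  have hpq : p.toReal.HolderConjugate q.toReal := ENNReal.HolderConjugate.toReal_of_ne_top hpt
    ((ENNReal.HolderConjugate.lt_top_iff_one_lt q p).2 hp1).ne
  have : Fact (1 ≤ p) := ⟨hp1.le⟩
  have hcoeff {g : α → ℂ} (hg : MemLp g p μ) (j : ι) :
      coeff μ (hg.toLp g) (e j) = coeff μ g (e j) :=
    integral_congr_ae (hg.coeFn_toLp.mono fun x hx ↦ by simp only [hx])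
  simp_rw [← Lp.norm_toLp f hf, ← hcoeff hf]
  refine (Lp.simpleFunc.denseRange hpt).induction_on (hf.toLp f) (isClosed_le ?_ continuous_norm)
    fun F ↦ ?_
  · have hcont (j : ι) := continuous_coeff (p := p) (q := q)
      (memLp_of_two_le (Lp.memLp (e j)) (htop j) (two_le_of_le_two hp2))
    exact (continuous_finsetSum _ fun j _ ↦ ((hcont j).norm.rpow_const
      fun _ ↦ Or.inr hpq.symm.nonneg).mul_const _).rpow_const fun _ ↦ Or.inr hpq.symm.one_div_nonneg
  · have hF := Lp.simpleFunc.memLp F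
    have hF_toLp : (F : Lp ℂ p μ) = hF.toLp _ :=
      congrArg Subtype.val (Lp.simpleFunc.toLp_toSimpleFunc F).symm
    have key := sum_rpow_norm_coeff_le_of_simpleFunc (J := J) hpq
      (by simpa using ENNReal.toReal_mono ENNReal.ofNat_ne_top hp2) he htop
      ((SimpleFunc.memLp_iff_finMeasSupp hp0 hpt).1 hF)
    simp_rw [hF_toLp, hcoeff hF, Lp.norm_toLp, hF.eLpNorm_eq_integral_rpow_norm hp0 hpt]
    rwa [ENNReal.toReal_ofReal (by positivity), ← one_div]

theorem tsum_rpow_enorm_coeff_le [p.HolderConjugate q] (hp1 : 1 < p) (hp2 : p ≤ 2)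
    (he : Orthonormal ℂ e) (htop : ∀ j, MemLp (e j) ∞ μ) {f : α → ℂ} (hf : MemLp f p μ) :
    (∑' j, ‖coeff μ f (e j)‖ₑ ^ q.toReal * eLpNorm (e j) ∞ μ ^ (2 - q.toReal)) ^ (1 / q.toReal) ≤
      eLpNorm f p μ := by
  have hq0 : 0 < q.toReal := ENNReal.toReal_pos (ENNReal.HolderConjugate.ne_zero q p)
    ((ENNReal.HolderConjugate.lt_top_iff_one_lt q p).2 hp1).ne
  have hterm (j : ι) : ‖coeff μ f (e j)‖ₑ ^ q.toReal * eLpNorm (e j) ∞ μ ^ (2 - q.toReal) =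
      ENNReal.ofReal (‖coeff μ f (e j)‖ ^ q.toReal * lpNorm (e j) ∞ μ ^ (2 - q.toReal)) := by
    rw [ENNReal.ofReal_mul (by positivity), ← ENNReal.ofReal_rpow_of_nonneg (norm_nonneg _) hq0.le,
      ← ENNReal.ofReal_rpow_of_pos (lpNorm_top_pos htop he.ne_zero j), ofReal_norm,
      ofReal_lpNorm (htop j)]
  have hnonneg (j : ι) : 0 ≤ ‖coeff μ f (e j)‖ ^ q.toReal * lpNorm (e j) ∞ μ ^ (2 - q.toReal) :=
    mul_nonneg (by positivity) (Real.rpow_nonneg lpNorm_nonneg _)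
  rw [one_div, ENNReal.rpow_inv_le_iff hq0, ENNReal.tsum_eq_iSup_sum]
  refine iSup_le fun J ↦ ?_
  rw [← ENNReal.rpow_inv_le_iff hq0, Finset.sum_congr rfl fun j _ ↦ hterm j,
    ← ENNReal.ofReal_sum_of_nonneg fun j _ ↦ hnonneg j,
    ENNReal.ofReal_rpow_of_nonneg (Finset.sum_nonneg fun j _ ↦ hnonneg j) (by positivity),
    ← one_div]
  exact ENNReal.ofReal_le_of_le_toReal (sum_rpow_norm_coeff_le hp1 hp2 he htop J hf)

end HausdorffYoungLp

section AnharmonicOscillator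

theorem abs_norm_pow_sub_le {E : Type*} [SeminormedAddCommGroup E] (m : ℕ) (x y : E) :
    |‖x‖ ^ m - ‖y‖ ^ m| ≤ m * 2 ^ m * ‖x - y‖ * (1 + ‖x - y‖) ^ m * (1 + ‖y‖ ^ m) := by
  have hxy : ‖x‖ ≤ ‖x - y‖ + ‖y‖ := norm_le_norm_sub_add x y
  have hprod : (1 + ‖x - y‖) * (1 + ‖y‖) = 1 + ‖x - y‖ + ‖y‖ + ‖x - y‖ * ‖y‖ := by ring
  have hpos : 0 ≤ ‖x - y‖ * ‖y‖ := by positivity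
  have hmax : max |‖x‖| |‖y‖| ≤ (1 + ‖x - y‖) * (1 + ‖y‖) := by
    rw [abs_norm, abs_norm, hprod]
    exact max_le (by linarith) (by linarith [norm_nonneg (x - y)])
  have hone : 1 ≤ (1 + ‖x - y‖) * (1 + ‖y‖) := by
    rw [hprod]; linarith [norm_nonneg (x - y), norm_nonneg y]
  have hpow : (1 + ‖y‖) ^ m ≤ 2 ^ m * (1 + ‖y‖ ^ m) := by
    have h := add_pow_le zero_le_one (norm_nonneg y) m
    rw [one_pow] at h
    refine h.trans (mul_le_mul_of_nonneg_right ?_ (by positivity))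
    exact pow_le_pow_right₀ one_le_two (Nat.sub_le m 1)
  calc |‖x‖ ^ m - ‖y‖ ^ m| ≤ |‖x‖ - ‖y‖| * m * max |‖x‖| |‖y‖| ^ (m - 1) :=
        abs_pow_sub_pow_le _ _ _
    _ ≤ ‖x - y‖ * m * ((1 + ‖x - y‖) * (1 + ‖y‖)) ^ m := by
        gcongr
        · exact abs_norm_sub_norm_le x y
        · exact (pow_le_pow_left₀ (by positivity) hmax _).trans
            (pow_le_pow_right₀ hone (Nat.sub_le m 1))
    _ = ‖x - y‖ * m * (1 + ‖x - y‖) ^ m * (1 + ‖y‖) ^ m := by rw [mul_pow]; ring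
    _ ≤ ‖x - y‖ * m * (1 + ‖x - y‖) ^ m * (2 ^ m * (1 + ‖y‖ ^ m)) := by gcongr
    _ = m * 2 ^ m * ‖x - y‖ * (1 + ‖x - y‖) ^ m * (1 + ‖y‖ ^ m) := by ring

theorem isSlowlyVarying_norm_pow {E : Type*} [NormedAddCommGroup E]
    [InnerProductSpace ℝ E] (k : ℕ) : IsSlowlyVarying fun x : E ↦ ‖x‖ ^ (2 * k) where
  nonneg x := by positivity
  hasTemperateGrowth := by
    simp only [pow_mul]
    fun_prop
  exists_abs_sub_le :=
    ⟨(2 * k : ℕ) * 2 ^ (2 * k), by positivity, 2 * k, abs_norm_pow_sub_le (2 * k)⟩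

theorem oscillator_apply {n k l : ℕ} (v : 𝓢'(Space n, ℂ)) (φ : 𝓢(Space n, ℂ)) :
    oscillator n k l v φ = v (polyLaplacian l φ) +
      v (SchwartzMap.smulLeftCLM ℂ (potential n k) φ) + v φ := by
  have h : ∀ (l : ℕ) (φ : 𝓢(Space n, ℂ)),
      ((fun w : 𝓢'(Space n, ℂ) ↦ -Δ w)^[l] v) φ = v (polyLaplacian l φ) := by
    intro l
    induction l with
    | zero => exact fun φ ↦ rfl
    | succ l ih =>
      intro φ
      rw [Function.iterate_succ_apply', polyLaplacian, Function.iterate_succ_apply,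
        ← polyLaplacian, ← ih]
      change -(Δ ((fun w : 𝓢'(Space n, ℂ) ↦ -Δ w)^[l] v)) φ = _
      rw [TemperedDistribution.laplacian_apply_apply, ← map_neg]
  rw [← h]
  rfl

theorem IsEigenfunction.isWeakSolution {n k l : ℕ} {v : L2 n} {μ : ℂ}
    (h : IsEigenfunction k l v μ) : IsWeakSolution (fun x ↦ ‖x‖ ^ (2 * k)) l v (μ - 1) := by
  intro φ
  have hφ : oscillator n k l v φ = μ • (v : 𝓢'(Space n, ℂ)) φ := DFunLike.congr_fun h.2 φ
  simp only [oscillator_apply, Lp.toTemperedDistribution_apply, smul_eq_mul, mul_comm _ (v _)]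
    at hφ
  have hint (ψ : 𝓢(Space n, ℂ)) : Integrable fun x ↦ v x * ψ x :=
    (Lp.memLp v).integrable_mul (ψ.memLp 2)
  have hpot (x : Space n) : v x * ((μ - 1 - (‖x‖ ^ (2 * k) : ℝ)) * φ x) =
      (μ - 1) * (v x * φ x) - v x * SchwartzMap.smulLeftCLM ℂ (potential n k) φ x := by
    rw [SchwartzMap.smulLeftCLM_apply_apply (potential_hasTemperateGrowth n k), potential,
      smul_eq_mul]
    ring
  simp only [hpot]
  rw [integral_sub ((hint φ).const_mul _) (hint _), integral_const_mul]
  linear_combination hφ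

theorem IsEigenfunction.supNorm_lt_top {n k l : ℕ} {v : L2 n} {μ : ℂ} (hl : 1 ≤ l)
    (h : IsEigenfunction k l v μ) : supNorm v < ∞ :=
  have : NeZero l := ⟨Nat.one_le_iff_ne_zero.1 hl⟩
  h.isWeakSolution.eLpNorm_top_lt_top (isSlowlyVarying_norm_pow k) (Lp.memLp v)
    (Lp.stronglyMeasurable v).measurable

theorem ellNorm_fourierCoeff_le {n : ℕ} {u : ℕ → L2 n} {p q : ℝ≥0∞} [p.HolderConjugate q]
    (hp : p ≤ 2) (hu : Orthonormal ℂ u) (htop : ∀ j, MemLp (u j) ∞) {f : Space n → ℂ}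
    (hf : MemLp f p) : ellNorm u q (fourierCoeff u f) ≤ eLpNorm f p := by
  rw [ellNorm]
  split_ifs with hq
  · subst hq
    refine iSup_le fun j ↦ ?_
    rw [← div_eq_mul_inv]
    exact ENNReal.div_le_of_le_mul (enorm_coeff_le hf (htop j))
  · exact tsum_rpow_enorm_coeff_le ((ENNReal.HolderConjugate.lt_top_iff_one_lt q p).1
      (lt_top_iff_ne_top.2 hq)) hp hu htop hf

end AnharmonicOscillator

end Anharmonic

theorem theorem3p1_general {n k l : ℕ} (hl : 1 ≤ l) {u : ℕ → Anharmonic.L2 n}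
    (hon : Orthonormal ℂ u) {eigenvalue : ℕ → ℂ}
    (hu : ∀ j, Anharmonic.IsEigenfunction k l (u j) (eigenvalue j))
    {p p' : ℝ≥0∞} (hp : p ≤ 2) (hpp' : 1 / p + 1 / p' = 1)
    {f : Anharmonic.Space n → ℂ} (hf : MemLp f p volume) :
    (∀ j, Anharmonic.supNorm (u j) < ∞) ∧
    (∀ j, Integrable (fun x ↦ f x * conj (u j x)) volume) ∧
    Anharmonic.ellNorm u p' (Anharmonic.fourierCoeff u f) ≤ eLpNorm f p volume := by
  have : p.HolderConjugate p' := ⟨by simpa using hpp'⟩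
  have hsup (j : ℕ) : Anharmonic.supNorm (u j) < ∞ := (hu j).supNorm_lt_top hl
  have htop (j : ℕ) : MemLp (u j) ∞ := ⟨(Lp.memLp (u j)).1, hsup j⟩
  have hdual (j : ℕ) : MemLp (u j) p' :=
    Anharmonic.memLp_of_two_le (Lp.memLp (u j)) (htop j) (Anharmonic.two_le_of_le_two (p := p) hp)
  exact ⟨hsup, fun j ↦ Anharmonic.integrable_mul_conj hf (hdual j),
    Anharmonic.ellNorm_fourierCoeff_le hp hon htop hf⟩

theorem theorem3p1 (n k l : ℕ) (hn : 1 ≤ n) (hk : 1 ≤ k) (hl : 1 ≤ l)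
    (u : HilbertBasis ℕ ℂ (Anharmonic.L2 n)) (eigenvalue : ℕ → ℂ)
    (hu : ∀ j, Anharmonic.IsEigenfunction k l (u j) (eigenvalue j))
    (p p' : ℝ≥0∞) (hp1 : 1 ≤ p) (hp2 : p ≤ 2) (hpp' : 1 / p + 1 / p' = 1)
    (f : Anharmonic.Space n → ℂ) (hf : MemLp f p volume) :
    (∀ j, Anharmonic.supNorm (u j) < ∞) ∧
    (∀ j, Integrable (fun x ↦ f x * conj (u j x)) volume) ∧
    Anharmonic.ellNorm u p' (Anharmonic.fourierCoeff u f) ≤ eLpNorm f p volume :=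
  theorem3p1_general hl u.orthonormal hu hp2 hpp' hf
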